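/- Setting. Let $\mathcal H=\mathbb C^{d}$ (for $N$ qubits, $d=2^N$), $T>0$, $\omega=2\pi/T$, and let $H(t)=\sum_{m=-M}^{M}H_m e^{-im\omega t}$ be Hermitian for every $t$ (that is, $H_m^\dagger=H_{-m}$) with $\|H_m\|\le\alpha$ for all $m$. Let $\{|\phi_n(t)\rangle\}_{n=1}^{d}$ be a complete set of Floquet eigenstates with quasienergies $\epsilon_n\in[-\omega/2,\omega/2)$: each $|\phi_n(t)\rangle$ is $T$-periodic, $e^{-i\epsilon_n t}|\phi_n(t)\rangle$ solves the Schrödinger equation $i\frac{d}{dt}|\psi(t)\rangle=H(t)|\psi(t)\rangle$, and $\{|\phi_n(t)\rangle\}_n$ is an orthonormal basis of $\mathcal H$ for every $t$. Write $|\phi_n(t)\rangle=\sum_{l\in\mathbb Z}e^{-il\omega t}|\phi_n^l\rangle$, and in the Sambe space $\ell^2(\mathbb Z)\otimes\mathcal H$ put $|\Phi_n^l\rangle=\sum_{l'\in\mathbb Z}|l'+l\rangle\otimes|\phi_n^{l'}\rangle$. For an integer $K\geq 1$ let $[K]=\{-K+1,\dots,K\}$. For an integer $L\ge1$ let $$|\Psi_{0,n}^L\rangle=\frac1{\sqrt{8L}}\sum_{l\in[4L]}|l\rangle\otimes|\phi_n(0)\rangle,\qquad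 P=\sum_{n'=1}^{d}\ \sum_{l\in[6L]\setminus[L+1]}|\Phi_{n'}^l\rangle\langle\Phi_{n'}^l| .$$ Statement. For every $M$ there are constants $C,c_1,c_2>0$, depending only on $M$, such that for all $d$, $T$, $\alpha$, $H$, all Floquet eigenstates as above, all $n$ and all $L\ge 1$ the following hold. (1) Norm of the residual: $$\left|\,\Big\|\,|\Psi_{0,n}^L\rangle-\frac1{\sqrt{8L}}\sum_{l\in[3L]}|\Phi_n^l\rangle\Big\|-\frac12\right|\le 27(2M+1)\exp\Big(-\frac{L}{2M+1}+\frac{\sinh 1}{2\pi}\,\alpha T\Big).$$ (2) Decomposition of the initial state: there are vectors $|\Psi_\perp\rangle$, $|\Psi_{\mathrm{neg}}\rangle$ in the Sambe space with $$|\Psi_{0,n}^L\rangle=\frac1{\sqrt{8L}}\sum_{l\in[3L]}|\Phi_n^l\rangle+\frac12|\Psi_\perp\rangle+|\Psi_{\mathrm{neg}}\rangle,$$ $\langle\Psi_\perp|\Psi_\perp\rangle=1$, $P|\Psi_\perp\rangle=|\Psi_\perp\rangle$, and $\|\,|\Psi_{\mathrm{neg}}\rangle\|\le C\,e^{-(c_1L-c_2\alpha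 T)}$ (that is, $e^{-\Theta(L-\alpha T)}$). -/

import Mathlib

noncomputable section

namespace Floquet

/-- The physical Hilbert space `ℂ^d` (an `N`-qubit system is the case `d = 2 ^ N`). -/
abbrev Phys (d : ℕ) : Type := EuclideanSpace ℂ (Fin d)

/-- The Sambe space: square-summable families `(ψ_l)_{l ∈ ℤ}` of vectors of `ℂ^d`, i.e. the
vectors `∑_l |l⟩ ⊗ ψ_l` of finite norm. -/
abbrev Sambe (d : ℕ) : Type := lp (fun _ : ℤ => Phys d) 2

/-- The Fourier index window `[K] = {-K+1, …, K}`. -/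
def window (K : ℕ) : Finset ℤ := Finset.Ioc (-(K : ℤ)) (K : ℤ)

/-- A time-periodic Hamiltonian `H(t) = ∑_{|m| ≤ M} H_m e^{-imωt}` on `ℂ^d`, of period `T > 0`.
The symmetry condition `(H_m)† = H_{-m}` says that every `H(t)` is Hermitian. -/
structure PeriodicHamiltonian (d M : ℕ) where
  T : ℝ
  T_pos : 0 < T
  coeff : ℤ → (Phys d →L[ℂ] Phys d)
  adjoint_coeff : ∀ m, ContinuousLinearMap.adjoint (coeff m) = coeff (-m)
  coeff_eq_zero : ∀ m : ℤ, (M : ℤ) < |m| → coeff m = 0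

variable {d M : ℕ}

/-- The frequency `ω = 2π / T`. -/
def PeriodicHamiltonian.ω (H : PeriodicHamiltonian d M) : ℝ := 2 * Real.pi / H.T

/-- The Hamiltonian `H(t)` at time `t`. -/
def PeriodicHamiltonian.at (H : PeriodicHamiltonian d M) (t : ℝ) : Phys d →L[ℂ] Phys d :=
  ∑ m ∈ Finset.Icc (-(M : ℤ)) (M : ℤ),
    Complex.exp (-(Complex.I * (m : ℂ) * (H.ω : ℂ) * (t : ℂ))) • H.coeff m

/-- A complete set of Floquet eigenstates `φ_n(t)` with quasienergies `ε_n` in the Brillouin zone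
`[-ω/2, ω/2)`: each `φ_n` is `T`-periodic, each `ψ_n(t) = e^{-iε_n t} φ_n(t)` solves the
Schrödinger equation `i ψ_n'(t) = H(t) ψ_n(t)`, and at each time the `d` vectors `φ_n(t)` form an
orthonormal basis of `ℂ^d`. -/
structure FloquetBasis (H : PeriodicHamiltonian d M) where
  ε : Fin d → ℝ
  φ : Fin d → ℝ → Phys d
  ε_mem : ∀ n, ε n ∈ Set.Ico (-(H.ω / 2)) (H.ω / 2)
  periodic : ∀ n t, φ n (t + H.T) = φ n t
  schrodinger : ∀ n t, HasDerivAt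
    (fun s : ℝ => Complex.exp (-(Complex.I * (ε n : ℂ) * (s : ℂ))) • φ n s)
    (-Complex.I • H.at t (Complex.exp (-(Complex.I * (ε n : ℂ) * (t : ℂ))) • φ n t)) t
  orthonormal : ∀ t, Orthonormal ℂ (fun n => φ n t)

namespace FloquetBasis

variable {H : PeriodicHamiltonian d M} (F : FloquetBasis H)

/-- The Fourier component `φ_n^l = T⁻¹ ∫_0^T e^{ilωt} φ_n(t) dt`, so that
`φ_n(t) = ∑_l e^{-ilωt} φ_n^l`. -/
def comp (n : Fin d) (l : ℤ) : Phys d :=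
  (H.T⁻¹ : ℝ) • ∫ t in (0 : ℝ)..H.T,
    Complex.exp (Complex.I * (l : ℂ) * (H.ω : ℂ) * (t : ℂ)) • F.φ n t

theorem continuous_φ (n : Fin d) : Continuous (F.φ n) := by
  have h : Continuous
      (fun s : ℝ => Complex.exp (-(Complex.I * (F.ε n : ℂ) * (s : ℂ))) • F.φ n s) :=
    continuous_iff_continuousAt.2 fun t => (F.schrodinger n t).continuousAt
  have h2 : Continuous (fun s : ℝ => Complex.exp (Complex.I * (F.ε n : ℂ) * (s : ℂ))) := by
    fun_prop
  refine (h2.smul h).congr fun s => ?_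
  simp only [Pi.smul_apply']
  rw [smul_smul, ← Complex.exp_add]
  simp

theorem comp_apply (n : Fin d) (l : ℤ) (j : Fin d) :
    F.comp n l j = fourierCoeffOn H.T_pos (fun t => F.φ n t j) (-l) := by
  have hc := F.continuous_φ n
  have hT := H.T_pos.ne'
  rw [fourierCoeffOn_eq_integral, comp]
  have hi : IntervalIntegrable
      (fun t : ℝ => Complex.exp (Complex.I * (l : ℂ) * (H.ω : ℂ) * (t : ℂ)) • F.φ n t)
      MeasureTheory.volume 0 H.T := by
    apply Continuous.intervalIntegrable
    fun_prop
  have := (EuclideanSpace.proj j : Phys d →L[ℂ] ℂ).intervalIntegral_comp_comm hi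
  simp only [PiLp.proj_apply] at this
  rw [PiLp.smul_apply, ← this]
  congr 1
  · simp
  · refine intervalIntegral.integral_congr fun t _ => ?_
    simp only [PiLp.smul_apply, neg_neg]
    congr 1
    rw [fourier_coe_apply]
    congr 1
    simp only [PeriodicHamiltonian.ω]
    push_cast
    rw [sub_zero]
    ring

theorem memℓp_comp (n : Fin d) : Memℓp (F.comp n) 2 := by
  have h1 : ∀ j : Fin d, Summable (fun l : ℤ => ‖F.comp n l j‖ ^ 2) := by
    intro j
    have hL : MeasureTheory.MemLp (fun t => F.φ n t j) 2
        (MeasureTheory.volume.restrict (Set.Ioc 0 H.T)) := by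
      have hc := F.continuous_φ n
      have hcj : Continuous (fun t => F.φ n t j) := by fun_prop
      obtain ⟨C, hC⟩ := isCompact_Icc.exists_bound_of_continuousOn
        (s := Set.Icc 0 H.T) hcj.continuousOn
      refine MeasureTheory.MemLp.of_bound hcj.aestronglyMeasurable C ?_
      filter_upwards [MeasureTheory.ae_restrict_mem measurableSet_Ioc] with t ht
      exact hC t (Set.Ioc_subset_Icc_self ht)
    have h := (hasSum_sq_fourierCoeffOn H.T_pos hL).summable
    have h' := (Equiv.neg ℤ).summable_iff.2 h
    refine h'.congr fun l => ?_
    simp [comp_apply]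
  refine (memℓp_gen_iff (by norm_num)).2 ?_
  have h2 := summable_sum (s := Finset.univ) (fun j _ => h1 j)
  refine h2.congr fun l => ?_
  simp [EuclideanSpace.norm_sq_eq]

/-- The Sambe-space eigenstate `|Φ_n⟩ = ∑_l |l⟩ ⊗ φ_n^l`. -/
def state (n : Fin d) : Sambe d := ⟨F.comp n, F.memℓp_comp n⟩

end FloquetBasis

/-- The translation `Add_l : ∑_{l'} |l'⟩ ⊗ ψ_{l'} ↦ ∑_{l'} |l' + l⟩ ⊗ ψ_{l'}` of the Sambe space. -/
def translate (l : ℤ) (Ψ : Sambe d) : Sambe d :=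
  ⟨fun l' => Ψ (l' - l), by
    have h := (memℓp_gen_iff (by norm_num)).1 (lp.memℓp Ψ)
    refine (memℓp_gen_iff (by norm_num)).2 ?_
    exact (Equiv.subRight l).summable_iff.2 h⟩

namespace FloquetBasis

variable {H : PeriodicHamiltonian d M} (F : FloquetBasis H)

/-- The shifted eigenstate `|Φ_n^l⟩ = Add_l |Φ_n⟩`. -/
def shifted (n : Fin d) (l : ℤ) : Sambe d := translate l (F.state n)

/-- The initial state `(8L)^{-1/2} ∑_{l ∈ [4L]} |l⟩ ⊗ φ_n(0)`. -/
def initial (L : ℕ) (n : Fin d) : Sambe d :=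
  (1 / Real.sqrt (8 * L) : ℝ) • ∑ l ∈ window (4 * L), lp.single 2 l (F.φ n 0)

/-- The main term `(8L)^{-1/2} ∑_{l ∈ [3L]} |Φ_n^l⟩`. -/
def mainTerm (L : ℕ) (n : Fin d) : Sambe d :=
  (1 / Real.sqrt (8 * L) : ℝ) • ∑ l ∈ window (3 * L), F.shifted n l

/-- The projection `∑_n ∑_{l ∈ [6L] ∖ [L+1]} |Φ_n^l⟩⟨Φ_n^l|`. -/
def highProj (L : ℕ) : Sambe d →L[ℂ] Sambe d :=
  ∑ n : Fin d, ∑ l ∈ window (6 * L) \ window (L + 1),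
    InnerProductSpace.rankOne ℂ (F.shifted n l) (F.shifted n l)

end FloquetBasis

end Floquet

end

noncomputable section

namespace Floquet

open scoped ComplexConjugate

variable {d M : ℕ}

namespace PeriodicHamiltonian

variable (H : PeriodicHamiltonian d M)

/-! The shifted eigenstates `F.shifted n' l` form a Hilbert basis of the Sambe space, so the
residual `R = F.initial L n - F.mainTerm L n` can be studied through its coefficients. The
coefficient of the initial state on `F.shifted n' l` is `(8L)^{-1/2}` times the inner product of
`φ_n(0)` with the sum of the Fourier components `φ_{n'}^j` over `j ∈ [4L] - l`. If these components
decay exponentially, then for `l` deep inside `[4L]` the sum is nearly `φ_{n'}(0)` and the inner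
product is nearly `δ_{n n'}`. For `l` far outside, it is nearly zero. Hence the overlap of initial
state and main term is nearly `6L/(8L) = 3/4`, and `‖R‖²` is nearly `1 + 3/4 - 2·(3/4) = 1/4`.
Moreover `R` lives almost entirely on the shifts near the edges of the window, which are those kept
by `P = F.highProj L`. Normalising `P R` gives `Ψperp`, and what is left is small.

The decay comes from continuing time to `iη/ω`, which multiplies the `l`-th component of `e^{-iε_n
t} φ_n(t)` by `exp((l + ε_n/ω)η)`. The squared `ℓ²` norm of the result (`energy`) obeys a Grönwall
inequality in `η`, because the Sambe eigenvalue equation `comp_eigen` couples only modes at distance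
at most `M`. Comparing `|η| = 1/(2M+1)` with `η = 0` gives `norm_sum_comp_le`. Differentiating the
series needs some decay beforehand, supplied by `exists_norm_comp_le`.

The argument is run for superpositions of all the `φ_n`, so that the decay is an operator-norm
bound. By duality (`sum_norm_sq_inner_le`) it controls the sum over `n'` of squared coefficients
without any factor of `d`. -/

theorem ω_pos : 0 < H.ω := div_pos Real.two_pi_pos H.T_pos

theorem ω_mul_T : H.ω * H.T = 2 * Real.pi := by
  rw [ω, div_mul_cancel₀ _ H.T_pos.ne']

theorem exp_int_mul_ω_mul_T (l : ℤ) :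
    Complex.exp (Complex.I * (l : ℂ) * (H.ω : ℂ) * (H.T : ℂ)) = 1 := by
  have h : (H.ω : ℂ) * (H.T : ℂ) = 2 * Real.pi := by exact_mod_cast H.ω_mul_T
  rw [mul_assoc, h, Complex.exp_eq_one_iff]
  exact ⟨l, by ring⟩

/-! ### Fourier components of vector-valued functions and Parseval's identity -/

section FourierComp

variable {E E' : Type*} [NormedAddCommGroup E] [NormedSpace ℂ E]
  [NormedAddCommGroup E'] [NormedSpace ℂ E']

/-- The Fourier component `T⁻¹ ∫_0^T e^{ilωt} f(t) dt` of a vector-valued function. -/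
def fourierComp (f : ℝ → E) (l : ℤ) : E :=
  (H.T⁻¹ : ℝ) • ∫ t in (0 : ℝ)..H.T,
    Complex.exp (Complex.I * (l : ℂ) * (H.ω : ℂ) * (t : ℂ)) • f t

theorem map_fourierComp [CompleteSpace E] [CompleteSpace E'] (A : E →L[ℂ] E') {f : ℝ → E}
    (hf : Continuous f) (l : ℤ) :
    A (H.fourierComp f l) = H.fourierComp (fun t => A (f t)) l := by
  have hi : IntervalIntegrable
      (fun t : ℝ => Complex.exp (Complex.I * (l : ℂ) * (H.ω : ℂ) * (t : ℂ)) • f t)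
      MeasureTheory.volume 0 H.T := by
    apply Continuous.intervalIntegrable
    fun_prop
  rw [fourierComp, fourierComp, ← Complex.coe_smul, ← Complex.coe_smul, map_smul,
    ← A.intervalIntegral_comp_comm hi]
  simp only [map_smul]

theorem fourierComp_add {f g : ℝ → E} (hf : Continuous f) (hg : Continuous g) (l : ℤ) :
    H.fourierComp (fun t => f t + g t) l = H.fourierComp f l + H.fourierComp g l := by
  simp only [fourierComp, smul_add]
  rw [intervalIntegral.integral_add, smul_add] <;>
  · apply Continuous.intervalIntegrable
    fun_prop

theorem fourierComp_smul (f : ℝ → E) (c : ℂ) (l : ℤ) :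
    H.fourierComp (fun t => c • f t) l = c • H.fourierComp f l := by
  simp only [fourierComp, smul_comm _ c]
  rw [intervalIntegral.integral_smul, smul_comm]

theorem fourierComp_exp_smul (f : ℝ → E) (k l : ℤ) :
    H.fourierComp
      (fun t => Complex.exp (-(Complex.I * (k : ℂ) * (H.ω : ℂ) * (t : ℂ))) • f t) l =
      H.fourierComp f (l - k) := by
  simp only [fourierComp, smul_smul, ← Complex.exp_add]
  push_cast
  congr 3 with t
  congr 2
  ring

theorem fourierComp_eq_fourierCoeffOn (f : ℝ → ℂ) (l : ℤ) :
    H.fourierComp f l = fourierCoeffOn H.T_pos f (-l) := by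
  rw [fourierCoeffOn_eq_integral, fourierComp]
  congr 1
  · simp
  · refine intervalIntegral.integral_congr fun t _ => ?_
    simp only [neg_neg]
    congr 1
    rw [fourier_coe_apply]
    congr 1
    simp only [PeriodicHamiltonian.ω]
    push_cast
    rw [sub_zero]
    ring

theorem hasSum_norm_sq_fourierComp {f : ℝ → ℂ} (hf : Continuous f) :
    HasSum (fun l => ‖H.fourierComp f l‖ ^ 2) (H.T⁻¹ * ∫ t in (0 : ℝ)..H.T, ‖f t‖ ^ 2) := by
  have hL : MeasureTheory.MemLp f 2 (MeasureTheory.volume.restrict (Set.Ioc 0 H.T)) := by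
    obtain ⟨C, hC⟩ := isCompact_Icc.exists_bound_of_continuousOn
      (s := Set.Icc 0 H.T) hf.continuousOn
    refine MeasureTheory.MemLp.of_bound hf.aestronglyMeasurable C ?_
    filter_upwards [MeasureTheory.ae_restrict_mem measurableSet_Ioc] with t ht
    exact hC t (Set.Ioc_subset_Icc_self ht)
  have h := hasSum_sq_fourierCoeffOn H.T_pos hL
  have h' := (Equiv.neg ℤ).hasSum_iff.2 h
  simp only [sub_zero, smul_eq_mul] at h'
  refine h'.congr_fun fun l => ?_
  simp [fourierComp_eq_fourierCoeffOn]

theorem hasSum_norm_sq_fourierComp_phys {f : ℝ → Phys d} (hf : Continuous f) :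
    HasSum (fun l => ‖H.fourierComp f l‖ ^ 2) (H.T⁻¹ * ∫ t in (0 : ℝ)..H.T, ‖f t‖ ^ 2) := by
  have hj : ∀ j : Fin d, Continuous fun t => f t j := fun j => by fun_prop
  have h := hasSum_sum (s := Finset.univ) fun j _ => H.hasSum_norm_sq_fourierComp (hj j)
  have hc : ∀ l j, H.fourierComp (fun t => f t j) l = H.fourierComp f l j := fun l j =>
    (H.map_fourierComp (EuclideanSpace.proj j : Phys d →L[ℂ] ℂ) hf l).symm
  simp only [hc, ← EuclideanSpace.norm_sq_eq, ← Finset.mul_sum] at h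
  rw [← intervalIntegral.integral_finsetSum] at h
  · simpa only [← EuclideanSpace.norm_sq_eq] using h
  · intro j _
    have := hj j
    apply Continuous.intervalIntegrable
    fun_prop

/-- Polarisation: Parseval for the norm is applied to `f + c • g` with `c = ±1, ±i`. -/
theorem hasSum_inner_fourierComp {f g : ℝ → Phys d} (hf : Continuous f) (hg : Continuous g) :
    HasSum (fun l => inner ℂ (H.fourierComp f l) (H.fourierComp g l))
      ((H.T⁻¹ : ℝ) * ∫ t in (0 : ℝ)..H.T, inner ℂ (f t) (g t)) := by
  have key : ∀ c : ℂ, HasSum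
      (fun l => ((‖H.fourierComp f l + c • H.fourierComp g l‖ : ℝ) : ℂ) ^ 2)
      ((H.T⁻¹ : ℝ) * ∫ t in (0 : ℝ)..H.T, ((‖f t + c • g t‖ : ℝ) : ℂ) ^ 2) := by
    intro c
    have h := H.hasSum_norm_sq_fourierComp_phys (f := fun t => f t + c • g t) (by fun_prop)
    have hl : ∀ l, H.fourierComp (fun t => f t + c • g t) l =
        H.fourierComp f l + c • H.fourierComp g l := fun l => by
      rw [H.fourierComp_add hf (by fun_prop), fourierComp_smul]
    simp only [hl] at h
    have h2 := h.mapL Complex.ofRealCLM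
    simp only [Complex.ofRealCLM_apply] at h2
    rw [Complex.ofReal_mul, ← intervalIntegral.integral_ofReal] at h2
    simpa only [Complex.ofReal_pow] using h2
  have hint : ∀ c : ℂ, IntervalIntegrable (fun t => ((‖f t + c • g t‖ : ℝ) : ℂ) ^ 2)
      MeasureTheory.volume 0 H.T := by
    intro c
    apply Continuous.intervalIntegrable
    fun_prop
  have h := ((((key 1).sub (key (-1))).add
    (((key (-Complex.I)).sub (key Complex.I)).mul_right Complex.I)).div_const 4)
  convert! h using 1
  · funext l
    rw [inner_eq_sum_norm_sq_div_four]
    simp [sub_eq_add_neg]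
  · rw [← mul_sub, ← mul_sub, mul_assoc, ← mul_add, mul_div_assoc]
    congr 1
    rw [← intervalIntegral.integral_sub (hint _) (hint _),
      ← intervalIntegral.integral_sub (hint _) (hint _),
      ← intervalIntegral.integral_mul_const, ← intervalIntegral.integral_add,
      ← intervalIntegral.integral_div]
    · refine intervalIntegral.integral_congr fun t _ => ?_
      rw [inner_eq_sum_norm_sq_div_four]
      simp [sub_eq_add_neg]
    · exact (hint _).sub (hint _)
    · exact ((hint _).sub (hint _)).mul_const _

end FourierComp

end PeriodicHamiltonian

/-! ### Eigenvalue equation, orthonormality and completeness in the Sambe space -/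

namespace FloquetBasis

variable {H : PeriodicHamiltonian d M} (F : FloquetBasis H)

theorem comp_eq_fourierComp (n : Fin d) : F.comp n = H.fourierComp (F.φ n) := rfl

theorem hasDerivAt_exp_smul_φ (n : Fin d) (l : ℤ) (t : ℝ) :
    HasDerivAt (fun s : ℝ => Complex.exp (Complex.I * (l : ℂ) * (H.ω : ℂ) * (s : ℂ)) • F.φ n s)
      (Complex.exp (Complex.I * (l : ℂ) * (H.ω : ℂ) * (t : ℂ)) •
        ((Complex.I * (F.ε n + l * H.ω : ℂ)) • F.φ n t - Complex.I • H.at t (F.φ n t))) t := by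
  have h1 : HasDerivAt (fun s : ℝ => Complex.exp (Complex.I * (F.ε n + l * H.ω : ℂ) * (s : ℂ)))
      (Complex.exp (Complex.I * (F.ε n + l * H.ω : ℂ) * (t : ℂ)) *
        (Complex.I * (F.ε n + l * H.ω : ℂ))) t := by
    have := ((Complex.ofRealCLM.hasDerivAt (x := t)).const_mul
      (Complex.I * (F.ε n + l * H.ω : ℂ))).cexp
    simpa using this
  have h := h1.smul (F.schrodinger n t)
  refine (h.congr_deriv ?_).congr_of_eventuallyEq (Filter.Eventually.of_forall fun s => ?_)
  · simp only [map_smul, smul_smul, smul_sub]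
    rw [add_comm, sub_eq_add_neg, ← neg_smul]
    congr 1
    · congr 1
      rw [mul_right_comm, ← Complex.exp_add]
      ring_nf
    · congr 1
      have : Complex.exp (Complex.I * (l : ℂ) * (H.ω : ℂ) * (t : ℂ)) =
          Complex.exp (Complex.I * (F.ε n + l * H.ω : ℂ) * (t : ℂ)) *
          Complex.exp (-(Complex.I * (F.ε n : ℂ) * (t : ℂ))) := by
        rw [← Complex.exp_add]
        ring_nf
      rw [this]
      ring
  · simp only [smul_smul, Pi.smul_apply']
    rw [← Complex.exp_add]
    ring_nf

/-- The eigenvalue equation of the Sambe Hamiltonian, read off Fourier mode by Fourier mode. -/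
theorem comp_eigen (n : Fin d) (l : ℤ) :
    ((F.ε n : ℂ) + l * H.ω) • F.comp n l =
      ∑ m ∈ Finset.Icc (-(M : ℤ)) (M : ℤ), H.coeff m (F.comp n (l - m)) := by
  have hc := F.continuous_φ n
  have hat : Continuous fun t => H.at t (F.φ n t) := by
    unfold PeriodicHamiltonian.at
    simp only [sum_apply, smul_apply]
    fun_prop
  have hint := intervalIntegral.integral_eq_sub_of_hasDerivAt
    (fun t _ => F.hasDerivAt_exp_smul_φ n l t)
    (Continuous.intervalIntegrable (by fun_prop) 0 H.T)
  -- Both factors are `T`-periodic, so the boundary terms cancel and the derivative integrates to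
  -- zero over a period.
  rw [H.exp_int_mul_ω_mul_T] at hint
  have hper : F.φ n H.T = F.φ n 0 := by simpa using F.periodic n 0
  simp only [hper, Complex.ofReal_zero, mul_zero, Complex.exp_zero, sub_self] at hint
  have h0 : H.fourierComp (fun t => (Complex.I * (F.ε n + l * H.ω : ℂ)) • F.φ n t +
      (-Complex.I) • H.at t (F.φ n t)) l = 0 := by
    rw [PeriodicHamiltonian.fourierComp]
    simp only [neg_smul, ← sub_eq_add_neg]
    rw [hint, smul_zero]
  rw [H.fourierComp_add (by fun_prop) (by fun_prop), H.fourierComp_smul, H.fourierComp_smul,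
    neg_smul, ← sub_eq_add_neg, sub_eq_zero, mul_smul] at h0
  have h1 := smul_right_injective _ Complex.I_ne_zero h0
  rw [comp_eq_fourierComp, h1]
  have hsum : ∀ s : Finset ℤ, H.fourierComp (fun t => ∑ m ∈ s,
      Complex.exp (-(Complex.I * (m : ℂ) * (H.ω : ℂ) * (t : ℂ))) • H.coeff m (F.φ n t)) l =
      ∑ m ∈ s, H.coeff m (H.fourierComp (F.φ n) (l - m)) := by
    intro s
    induction s using Finset.induction_on with
    | empty => simp [PeriodicHamiltonian.fourierComp]
    | insert a s ha ih =>
      simp only [Finset.sum_insert ha]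
      rw [H.fourierComp_add (by fun_prop) (by fun_prop), ih, H.fourierComp_exp_smul,
        H.map_fourierComp _ hc]
  rw [← hsum]
  congr 1
  ext1 t
  simp [PeriodicHamiltonian.at]

theorem shifted_apply (n : Fin d) (l k : ℤ) : F.shifted n l k = F.comp n (k - l) := rfl

/-- A shift by `l` in the Sambe space is multiplication by `e^{-ilωt}` in time. By Parseval the
inner product is the period average of `e^{i(l-l')ωt} ⟨φ_n(t), φ_{n'}(t)⟩`, where the second factor
is `δ_{n n'}` at every time. -/
theorem orthonormal_shifted : Orthonormal ℂ (fun p : Fin d × ℤ => F.shifted p.1 p.2) := by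
  rw [orthonormal_iff_ite]
  rintro ⟨n, l⟩ ⟨n', l'⟩
  have hc := F.continuous_φ n
  have hc' := F.continuous_φ n'
  have h := H.hasSum_inner_fourierComp
    (f := fun t => Complex.exp (-(Complex.I * (l : ℂ) * (H.ω : ℂ) * (t : ℂ))) • F.φ n t)
    (g := fun t => Complex.exp (-(Complex.I * (l' : ℂ) * (H.ω : ℂ) * (t : ℂ))) • F.φ n' t)
    (by fun_prop) (by fun_prop)
  simp only [H.fourierComp_exp_smul] at h
  have h2 := lp.hasSum_inner (𝕜 := ℂ) (F.shifted n l) (F.shifted n' l')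
  simp only [shifted_apply, comp_eq_fourierComp] at h2
  rw [h2.unique h]
  have hin : ∀ t : ℝ, inner ℂ
      (Complex.exp (-(Complex.I * (l : ℂ) * (H.ω : ℂ) * (t : ℂ))) • F.φ n t)
      (Complex.exp (-(Complex.I * (l' : ℂ) * (H.ω : ℂ) * (t : ℂ))) • F.φ n' t) =
      Complex.exp (Complex.I * ((l - l' : ℤ) : ℂ) * (H.ω : ℂ) * (t : ℂ)) *
        if n = n' then 1 else 0 := by
    intro t
    rw [inner_smul_left, inner_smul_right, orthonormal_iff_ite.1 (F.orthonormal t), ← mul_assoc,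
      ← Complex.exp_conj, ← Complex.exp_add]
    congr 2
    simp
    ring
  simp only [hin]
  rw [intervalIntegral.integral_mul_const]
  have hT : (H.T : ℂ) ≠ 0 := by exact_mod_cast H.T_pos.ne'
  by_cases hl : l = l'
  · subst hl
    simp [hT]
  · have hne : Complex.I * ((l - l' : ℤ) : ℂ) * (H.ω : ℂ) ≠ 0 := by
      refine mul_ne_zero (mul_ne_zero Complex.I_ne_zero ?_) ?_
      · exact_mod_cast sub_ne_zero.2 hl
      · exact_mod_cast H.ω_pos.ne'
    rw [integral_exp_mul_complex hne, H.exp_int_mul_ω_mul_T]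
    simp [hl]

theorem norm_comp_le_one (n : Fin d) (l : ℤ) : ‖F.comp n l‖ ≤ 1 := by
  have h := lp.norm_apply_le_norm (by norm_num) (F.shifted n 0) l
  rwa [F.orthonormal_shifted.1 (n, 0), shifted_apply, sub_zero] at h

theorem hasSum_norm_sq_inner_comp (v : Phys d) (n : Fin d) :
    HasSum (fun l => ‖inner ℂ v (F.comp n l)‖ ^ 2)
      (H.T⁻¹ * ∫ t in (0 : ℝ)..H.T, ‖inner ℂ v (F.φ n t)‖ ^ 2) := by
  have hc := F.continuous_φ n
  have h := H.hasSum_norm_sq_fourierComp (f := fun t => innerSL ℂ v (F.φ n t)) (by fun_prop)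
  simp only [← H.map_fourierComp _ hc] at h
  exact h

theorem sum_norm_sq_inner_φ (v : Phys d) (t : ℝ) :
    ∑ n, ‖inner ℂ v (F.φ n t)‖ ^ 2 = ‖v‖ ^ 2 := by
  rcases Nat.eq_zero_or_pos d with rfl | hd
  · simp [Subsingleton.elim v 0]
  have : Nonempty (Fin d) := ⟨⟨0, hd⟩⟩
  have hcard : Fintype.card (Fin d) = Module.finrank ℂ (Phys d) := by simp
  let b := basisOfOrthonormalOfCardEqFinrank (F.orthonormal t) hcard
  have hb : Orthonormal ℂ b := by
    simpa [b] using F.orthonormal t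
  have := (b.toOrthonormalBasis hb).sum_sq_norm_inner_left v
  simpa [b] using this

/-- With the sum over `n` moved inside the time average, the integrand is the constant `‖v‖²`, since
the `φ_n(t)` are an orthonormal basis at each `t`. -/
theorem hasSum_norm_sq_inner_comp_sum (v : Phys d) :
    HasSum (fun l => ∑ n, ‖inner ℂ v (F.comp n l)‖ ^ 2) (‖v‖ ^ 2) := by
  have h := hasSum_sum (s := Finset.univ) fun n _ => F.hasSum_norm_sq_inner_comp v n
  rw [← Finset.mul_sum, ← intervalIntegral.integral_finsetSum] at h
  · simp only [F.sum_norm_sq_inner_φ] at h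
    rw [intervalIntegral.integral_const, sub_zero, smul_eq_mul,
      inv_mul_cancel_left₀ H.T_pos.ne'] at h
    exact h
  · intro n _
    have hc := F.continuous_φ n
    apply Continuous.intervalIntegrable
    fun_prop

/-- Parseval's identity for one basis vector `|l⟩ ⊗ v` of the Sambe space already gives the
completeness of the shifted eigenstates. -/
theorem orthogonal_span_shifted :
    (Submodule.span ℂ (Set.range fun p : Fin d × ℤ => F.shifted p.1 p.2))ᗮ = ⊥ := by
  rw [Submodule.eq_bot_iff]
  intro x hx
  have hx' : ∀ p : Fin d × ℤ, inner ℂ (F.shifted p.1 p.2) x = 0 := fun p =>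
    (Submodule.mem_orthogonal _ x).1 hx _ (Submodule.subset_span ⟨p, rfl⟩)
  ext1
  funext k
  set v : Phys d := x k with hv
  set e : Sambe d := lp.single 2 k v with he
  have hn : HasSum (fun p : Fin d × ℤ => ‖inner ℂ (F.shifted p.1 p.2) e‖ ^ 2) (‖e‖ ^ 2) := by
    have hb : Summable (fun p : Fin d × ℤ => ‖inner ℂ (F.shifted p.1 p.2) e‖ ^ 2) :=
      F.orthonormal_shifted.inner_products_summable (x := e)
    have hs := hb.hasSum
    have hs2 := ((Equiv.prodComm ℤ (Fin d)).hasSum_iff.2 hs).prod_fiberwise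
      (fun l => hasSum_fintype _)
    have h1 := F.hasSum_norm_sq_inner_comp_sum v
    have h1' := ((Equiv.subLeft k).hasSum_iff).2 h1
    have he2 : ‖e‖ = ‖v‖ := lp.norm_single (by norm_num) _ _
    rw [he2]
    convert hs using 1
    refine h1'.unique ?_
    convert hs2 using 2 with l
    simp only [Function.comp, Equiv.prodComm_apply, Prod.swap, he, lp.inner_single_right,
      shifted_apply, Equiv.subLeft_apply]
    exact Finset.sum_congr rfl fun n _ => by rw [norm_inner_symm]
  have hie : inner ℂ e x = (‖v‖ : ℂ) ^ 2 := by
    rw [he, lp.inner_single_left, hv, inner_self_eq_norm_sq_to_K]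
    rfl
  -- The partial expansion `y` of `e` is orthogonal to `x`, so `⟨e, x⟩ = ⟨e - y, x⟩`. Cauchy–Schwarz
  -- bounds this by the Parseval defect of `e`, which tends to zero, whereas `⟨e, x⟩ = ‖v‖²`.
  have hbound : ∀ s : Finset (Fin d × ℤ), ‖inner ℂ e x‖ ^ 2 ≤
      (‖e‖ ^ 2 - ∑ p ∈ s, ‖inner ℂ (F.shifted p.1 p.2) e‖ ^ 2) * ‖x‖ ^ 2 := by
    intro s
    set y := ∑ p ∈ s, inner ℂ (F.shifted p.1 p.2) e • F.shifted p.1 p.2 with hy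
    have hyx : inner ℂ y x = 0 := by
      rw [hy, sum_inner]
      exact Finset.sum_eq_zero fun p _ => by rw [inner_smul_left, hx', mul_zero]
    have hyy : ‖y‖ ^ 2 = ∑ p ∈ s, ‖inner ℂ (F.shifted p.1 p.2) e‖ ^ 2 := by
      have := F.orthonormal_shifted.inner_sum (fun p => inner ℂ (F.shifted p.1 p.2) e)
        (fun p => inner ℂ (F.shifted p.1 p.2) e) s
      rw [← hy, inner_self_eq_norm_sq_to_K] at this
      apply Complex.ofReal_injective
      push_cast
      rw [show ((‖y‖ : ℂ)) ^ 2 = _ from this]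
      exact Finset.sum_congr rfl fun p _ => Complex.conj_mul' _
    have hye : inner ℂ y e = (‖y‖ : ℂ) ^ 2 := by
      have h3 : ((‖y‖ ^ 2 : ℝ) : ℂ) = _ := congrArg Complex.ofReal hyy
      push_cast at h3
      rw [h3, hy, sum_inner]
      exact Finset.sum_congr rfl fun p _ => by rw [inner_smul_left, Complex.conj_mul']
    have hsub : ‖e - y‖ ^ 2 = ‖e‖ ^ 2 - ‖y‖ ^ 2 := by
      rw [@norm_sub_sq ℂ, ← inner_conj_symm, hye]
      simp
      norm_cast
      ring
    rw [← hyy, ← hsub, ← mul_pow]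
    have : inner ℂ e x = inner ℂ (e - y) x := by rw [inner_sub_left, hyx, sub_zero]
    rw [this]
    gcongr
    exact norm_inner_le_norm _ _
  have hlim : Filter.Tendsto (fun s : Finset (Fin d × ℤ) =>
      (‖e‖ ^ 2 - ∑ p ∈ s, ‖inner ℂ (F.shifted p.1 p.2) e‖ ^ 2) * ‖x‖ ^ 2) Filter.atTop
      (nhds ((‖e‖ ^ 2 - ‖e‖ ^ 2) * ‖x‖ ^ 2)) := (hn.const_sub _).mul_const _
  have h0 := ge_of_tendsto' hlim hbound
  rw [sub_self, zero_mul, hie] at h0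
  have : ‖v‖ = 0 := by
    by_contra hne
    have : 0 < ‖v‖ := lt_of_le_of_ne (norm_nonneg _) (Ne.symm hne)
    have h4 : 0 < ‖((‖v‖ : ℂ)) ^ 2‖ ^ 2 := by
      rw [norm_pow, Complex.norm_real, norm_norm]
      positivity
    linarith
  exact norm_eq_zero.1 this

/-- The shifted eigenstates as a Hilbert basis of the Sambe space. -/
def hilbertBasis : HilbertBasis (Fin d × ℤ) ℂ (Sambe d) :=
  HilbertBasis.mkOfOrthogonalEqBot F.orthonormal_shifted F.orthogonal_span_shifted

theorem hilbertBasis_apply (p : Fin d × ℤ) : F.hilbertBasis p = F.shifted p.1 p.2 := by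
  rw [hilbertBasis, HilbertBasis.coe_mkOfOrthogonalEqBot]

theorem hasSum_norm_sq_inner_shifted (x : Sambe d) :
    HasSum (fun l => ∑ n, ‖inner ℂ (F.shifted n l) x‖ ^ 2) (‖x‖ ^ 2) := by
  have h := F.hilbertBasis.hasSum_inner_mul_inner x x
  have h1 := ((Equiv.prodComm ℤ (Fin d)).hasSum_iff.2 h).prod_fiberwise
      (fun l => hasSum_fintype _)
  have h2 := h1.mapL Complex.reCLM
  simp only [Complex.reCLM_apply] at h2
  convert h2 using 1
  · funext l
    rw [Complex.re_sum]
    refine Finset.sum_congr rfl fun n _ => ?_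
    simp only [Function.comp, Equiv.prodComm_apply, Prod.swap, hilbertBasis_apply]
    rw [← inner_conj_symm x, Complex.conj_mul', ← Complex.ofReal_pow, Complex.ofReal_re]
  · rw [inner_self_eq_norm_sq_to_K]
    norm_cast

end FloquetBasis

end Floquet

end

noncomputable section

/-! ### Sums of exponentials over the integers -/

namespace Floquet

variable {d M : ℕ}

theorem sum_pow_natAbs_le {r : ℝ} (h0 : 0 ≤ r) (h1 : r < 1) {k : ℕ} {J : Finset ℤ}
    (hJ : ∀ j ∈ J, k ≤ j.natAbs) : ∑ j ∈ J, r ^ j.natAbs ≤ 2 * r ^ k / (1 - r) := by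
  set K := J.sup Int.natAbs with hK
  set A : Finset ℤ := (Finset.Ico k (K + 1)).image fun i : ℕ => (i : ℤ)
  set B : Finset ℤ := (Finset.Ico k (K + 1)).image fun i : ℕ => -(i : ℤ)
  have hsub : J ⊆ A ∪ B := by
    intro j hj
    have hjk := hJ j hj
    have hjK : j.natAbs ≤ K := Finset.le_sup (f := Int.natAbs) hj
    have hm : j.natAbs ∈ Finset.Ico k (K + 1) := Finset.mem_Ico.2 ⟨hjk, by omega⟩
    rcases Int.natAbs_eq j with h | h
    · exact Finset.mem_union_left _ (Finset.mem_image.2 ⟨_, hm, h.symm⟩)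
    · exact Finset.mem_union_right _ (Finset.mem_image.2 ⟨_, hm, h.symm⟩)
  have hpos : ∀ j : ℤ, 0 ≤ r ^ j.natAbs := fun j => pow_nonneg h0 _
  have hA : ∑ j ∈ A, r ^ j.natAbs ≤ r ^ k / (1 - r) := by
    rw [Finset.sum_image (by intro x _ y _ h; simpa using h)]
    simpa using geom_sum_Ico_le_of_lt_one h0 h1
  have hB : ∑ j ∈ B, r ^ j.natAbs ≤ r ^ k / (1 - r) := by
    rw [Finset.sum_image (by intro x _ y _ h; simpa using h)]
    simpa using geom_sum_Ico_le_of_lt_one h0 h1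
  calc ∑ j ∈ J, r ^ j.natAbs ≤ ∑ j ∈ A ∪ B, r ^ j.natAbs :=
        Finset.sum_le_sum_of_subset_of_nonneg hsub fun j _ _ => hpos j
    _ ≤ ∑ j ∈ A, r ^ j.natAbs + ∑ j ∈ B, r ^ j.natAbs := by
        rw [← Finset.sum_union_inter]
        exact le_add_of_nonneg_right (Finset.sum_nonneg fun j _ => hpos j)
    _ ≤ 2 * r ^ k / (1 - r) := by
        rw [mul_div_assoc, two_mul]
        exact add_le_add hA hB

theorem summable_pow_natAbs {r : ℝ} (h0 : 0 ≤ r) (h1 : r < 1) :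
    Summable fun j : ℤ => r ^ j.natAbs :=
  summable_of_sum_le (fun _ => pow_nonneg h0 _) fun J =>
    sum_pow_natAbs_le (k := 0) h0 h1 (J := J) fun _ _ => Nat.zero_le _

theorem exp_neg_mul_abs_eq_pow (κ : ℝ) (l : ℤ) :
    Real.exp (-(κ * |(l : ℝ)|)) = Real.exp (-κ) ^ l.natAbs := by
  rw [← Real.exp_nat_mul]
  congr 1
  rw [Nat.cast_natAbs]
  push_cast
  ring

theorem summable_exp_neg_mul_abs {κ : ℝ} (hκ : 0 < κ) :
    Summable fun l : ℤ => Real.exp (-(κ * |(l : ℝ)|)) := by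
  simp only [exp_neg_mul_abs_eq_pow]
  exact summable_pow_natAbs (Real.exp_pos _).le (Real.exp_zero ▸ Real.exp_lt_exp.2 (by linarith))

/-- Averaging with `m ↦ -m` turns each exponential into a `cosh`. Enlarging `|m| ≤ M` to `2M+1` is
wasteful, but makes the bound exactly the derivative of `sinh((2M+1)η)`, ready to be integrated. -/
theorem sum_exp_le_cosh (M : ℕ) (η : ℝ) :
    ∑ m ∈ Finset.Icc (-(M : ℤ)) (M : ℤ), Real.exp (m * η) ≤
      (2 * M + 1) * Real.cosh ((2 * M + 1) * η) := by
  have hneg : ∑ m ∈ Finset.Icc (-(M : ℤ)) (M : ℤ), Real.exp (m * η) =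
      ∑ m ∈ Finset.Icc (-(M : ℤ)) (M : ℤ), Real.exp (-(m * η)) := by
    refine Finset.sum_nbij' (fun m => -m) (fun m => -m) ?_ ?_ ?_ ?_ ?_
    · intro m hm
      rw [Finset.mem_Icc] at hm ⊢
      omega
    · intro m hm
      rw [Finset.mem_Icc] at hm ⊢
      omega
    · intro m _
      simp
    · intro m _
      simp
    · intro m _
      simp
  have hcosh : ∑ m ∈ Finset.Icc (-(M : ℤ)) (M : ℤ), Real.exp (m * η) =
      ∑ m ∈ Finset.Icc (-(M : ℤ)) (M : ℤ), Real.cosh (m * η) := by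
    simp only [Real.cosh_eq, ← Finset.sum_div, Finset.sum_add_distrib]
    rw [← hneg]
    ring
  rw [hcosh]
  calc ∑ m ∈ Finset.Icc (-(M : ℤ)) (M : ℤ), Real.cosh (m * η)
      ≤ ∑ m ∈ Finset.Icc (-(M : ℤ)) (M : ℤ), Real.cosh ((2 * M + 1) * η) := by
        refine Finset.sum_le_sum fun m hm => ?_
        rw [Finset.mem_Icc] at hm
        rw [Real.cosh_le_cosh, abs_mul, abs_mul]
        refine mul_le_mul_of_nonneg_right ?_ (abs_nonneg _)
        rw [abs_of_nonneg (by positivity : (0 : ℝ) ≤ 2 * M + 1), abs_le]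
        have h1 : (-(M : ℝ)) ≤ m := by exact_mod_cast hm.1
        have h2 : (m : ℝ) ≤ M := by exact_mod_cast hm.2
        have h3 : (0 : ℝ) ≤ M := by positivity
        constructor <;> linarith
    _ = _ := by
        rw [Finset.sum_const, Int.card_Icc, nsmul_eq_mul]
        congr 1
        have : ((M : ℤ) + 1 - -(M : ℤ)).toNat = 2 * M + 1 := by omega
        rw [this]
        push_cast
        ring

/-! ### Exponential decay of the Fourier components -/

namespace FloquetBasis

variable {H : PeriodicHamiltonian d M} (F : FloquetBasis H)

theorem abs_ε_div_ω_le (n : Fin d) : |F.ε n / H.ω| ≤ 1 / 2 := by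
  have h := F.ε_mem n
  have hω := H.ω_pos
  rw [abs_div, abs_of_pos hω, div_le_iff₀ hω, abs_le]
  constructor <;> linarith [h.1, h.2]

/-- Since `|ε_n| ≤ ω/2`, the scalar `ε_n + lω` in the eigenvalue equation has modulus at least `|l|ω
- ω/2`. -/
theorem norm_comp_mul_le {α : ℝ} (hα : ∀ m, ‖H.coeff m‖ ≤ α) (n : Fin d) (l : ℤ) :
    (|(l : ℝ)| * H.ω - H.ω / 2) * ‖F.comp n l‖ ≤
      ∑ m ∈ Finset.Icc (-(M : ℤ)) (M : ℤ), α * ‖F.comp n (l - m)‖ := by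
  have hω := H.ω_pos
  have h1 : |(l : ℝ)| * H.ω - H.ω / 2 ≤ ‖(F.ε n : ℂ) + l * H.ω‖ := by
    have h2 : (F.ε n : ℂ) + l * H.ω = ((F.ε n + l * H.ω : ℝ) : ℂ) := by push_cast; rfl
    rw [h2, Complex.norm_real, Real.norm_eq_abs]
    have h3 : |(l : ℝ) * H.ω| = |(l : ℝ)| * H.ω := by rw [abs_mul, abs_of_pos hω]
    have h4 : |F.ε n| ≤ H.ω / 2 := abs_le.2 ⟨(F.ε_mem n).1, (F.ε_mem n).2.le⟩
    have h5 := abs_sub_abs_le_abs_sub ((l : ℝ) * H.ω) (-F.ε n)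
    rw [abs_neg, sub_neg_eq_add, add_comm _ (F.ε n)] at h5
    linarith
  calc _ ≤ ‖(F.ε n : ℂ) + l * H.ω‖ * ‖F.comp n l‖ := by gcongr
    _ = ‖∑ m ∈ Finset.Icc (-(M : ℤ)) (M : ℤ), H.coeff m (F.comp n (l - m))‖ := by
        rw [← norm_smul, comp_eigen]
    _ ≤ _ := norm_sum_le_of_le _ fun m _ => (H.coeff m).le_of_opNorm_le (hα m) _

/-- A qualitative decay bound, at a rate exceeding every rate used below. -/
theorem exists_norm_comp_le {α : ℝ} (hα : ∀ m, ‖H.coeff m‖ ≤ α) (n : Fin d) :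
    ∃ C, 0 ≤ C ∧ ∀ l : ℤ, ‖F.comp n l‖ ≤ C * Real.exp (-(3 * |(l : ℝ)|)) := by
  have hω := H.ω_pos
  have hα0 : 0 ≤ α := (norm_nonneg _).trans (hα 0)
  -- `q` pays both for the loss of `M` in `|l - m| ≥ |l| - M` and for the gain of one unit in the
  -- induction below. Beyond the threshold `k` the diagonal term dominates the coupling by the
  -- factor `1/q`.
  set q := Real.exp (-(3 * (M + 1 : ℝ))) with hq
  have hqpos : 0 < q := Real.exp_pos _
  obtain ⟨k, hk⟩ := exists_nat_ge (((2 * M + 1) * α / q + H.ω / 2) / H.ω)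
  rw [div_le_iff₀ hω] at hk
  have hk' : (2 * M + 1) * α ≤ q * (k * H.ω - H.ω / 2) := by
    rw [← div_le_iff₀' hqpos]
    linarith
  have hD : (0 : ℝ) < 2 * M + 1 := by positivity
  -- Bootstrap: each use of the eigenvalue equation extends the exponential bound from distance `j`
  -- to `j + 1`. The prefactor `exp(3k)` makes the bound trivial for `|l| ≤ k`.
  have claim : ∀ j : ℕ, ∀ l : ℤ, ‖F.comp n l‖ ≤
      Real.exp (3 * k) * Real.exp (-(3 * min |(l : ℝ)| j)) := by
    intro j
    induction j with
    | zero =>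
      intro l
      have : min |(l : ℝ)| ((0 : ℕ) : ℝ) = 0 := by simp
      rw [this]
      refine (F.norm_comp_le_one n l).trans ?_
      simp
    | succ j ih =>
      intro l
      by_cases hl : |(l : ℝ)| ≤ k
      · refine (F.norm_comp_le_one n l).trans ?_
        rw [← Real.exp_add]
        refine Real.one_le_exp ?_
        have := min_le_left |(l : ℝ)| ((j + 1 : ℕ) : ℝ)
        linarith
      · push Not at hl
        have hl1 : (1 : ℝ) ≤ |(l : ℝ)| := by
          have h0 : 0 < |(l : ℝ)| := lt_of_le_of_lt (Nat.cast_nonneg k) hl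
          have h1 : (0 : ℤ) < |l| := by exact_mod_cast h0
          exact_mod_cast h1
        have hpos : 0 < |(l : ℝ)| * H.ω - H.ω / 2 := by nlinarith
        have hstep : ∑ m ∈ Finset.Icc (-(M : ℤ)) (M : ℤ), α * ‖F.comp n (l - m)‖ ≤
            (2 * M + 1) * α * (Real.exp (3 * k) * Real.exp (-(3 * min (|(l : ℝ)| - M) j))) := by
          have hterm : ∀ m ∈ Finset.Icc (-(M : ℤ)) (M : ℤ), α * ‖F.comp n (l - m)‖ ≤
              α * (Real.exp (3 * k) * Real.exp (-(3 * min (|(l : ℝ)| - M) j))) := by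
            intro m hm
            rw [Finset.mem_Icc] at hm
            refine mul_le_mul_of_nonneg_left ((ih (l - m)).trans ?_) hα0
            have hm' : |(m : ℝ)| ≤ M := abs_le.2 ⟨by exact_mod_cast hm.1, by exact_mod_cast hm.2⟩
            have hlm : |(l : ℝ)| - M ≤ |((l - m : ℤ) : ℝ)| := by
              push_cast
              linarith [abs_sub_abs_le_abs_sub (l : ℝ) m]
            gcongr
          refine (Finset.sum_le_sum hterm).trans_eq ?_
          rw [Finset.sum_const, Int.card_Icc, nsmul_eq_mul]
          have : ((M : ℤ) + 1 - -(M : ℤ)).toNat = 2 * M + 1 := by omega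
          rw [this]
          push_cast
          ring
        have h := (F.norm_comp_mul_le hα n l).trans hstep
        have hmin : q * Real.exp (-(3 * min (|(l : ℝ)| - M) j)) ≤
            Real.exp (-(3 * min |(l : ℝ)| ((j + 1 : ℕ) : ℝ))) := by
          rw [hq, ← Real.exp_add, Real.exp_le_exp]
          push_cast
          have h1 : (0 : ℝ) ≤ M := by positivity
          rcases le_total (|(l : ℝ)| - M) j with h2 | h2
          · rw [min_eq_left h2]
            linarith [min_le_left |(l : ℝ)| ((j : ℝ) + 1)]
          · rw [min_eq_right h2]
            linarith [min_le_right |(l : ℝ)| ((j : ℝ) + 1)]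
        refine le_of_mul_le_mul_left (h.trans ?_) hpos
        calc _ ≤ (q * (k * H.ω - H.ω / 2)) *
              (Real.exp (3 * k) * Real.exp (-(3 * min (|(l : ℝ)| - M) j))) := by gcongr
          _ ≤ (q * (|(l : ℝ)| * H.ω - H.ω / 2)) *
              (Real.exp (3 * k) * Real.exp (-(3 * min (|(l : ℝ)| - M) j))) := by gcongr
          _ = (|(l : ℝ)| * H.ω - H.ω / 2) *
              (Real.exp (3 * k) * (q * Real.exp (-(3 * min (|(l : ℝ)| - M) j)))) := by ring
          _ ≤ _ := by gcongr
  refine ⟨Real.exp (3 * k), (Real.exp_pos _).le, fun l => ?_⟩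
  have h := claim l.natAbs l
  rwa [Nat.cast_natAbs, Int.cast_abs, min_self] at h

/-- The Fourier component of a superposition `∑_n a_n e^{-iε_n t} φ_n(t)` after continuation to
the imaginary time `iη/ω`. -/
def weighted (a : Fin d → ℂ) (η : ℝ) (l : ℤ) : Phys d :=
  ∑ n, (a n * (Real.exp ((l + F.ε n / H.ω) * η) : ℂ)) • F.comp n l

theorem hasDerivAt_weighted (a : Fin d → ℂ) (η : ℝ) (l : ℤ) :
    HasDerivAt (fun η => F.weighted a η l)
      ((H.ω⁻¹ : ℂ) • ∑ m ∈ Finset.Icc (-(M : ℤ)) (M : ℤ),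
        (Real.exp (m * η) : ℂ) • H.coeff m (F.weighted a η (l - m))) η := by
  have hω : (H.ω : ℂ) ≠ 0 := by exact_mod_cast H.ω_pos.ne'
  have h : ∀ n ∈ Finset.univ, HasDerivAt
      (fun η : ℝ => (a n * (Real.exp ((l + F.ε n / H.ω) * η) : ℂ)) • F.comp n l)
      ((a n * ((Real.exp ((l + F.ε n / H.ω) * η) * (l + F.ε n / H.ω) : ℝ) : ℂ)) • F.comp n l)
      η := by
    intro n _
    have h1 : HasDerivAt (fun η : ℝ => Real.exp ((l + F.ε n / H.ω) * η))
        (Real.exp ((l + F.ε n / H.ω) * η) * (l + F.ε n / H.ω)) η := by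
      simpa using ((hasDerivAt_id η).const_mul (l + F.ε n / H.ω)).exp
    exact (h1.ofReal_comp.const_mul (a n)).smul_const (F.comp n l)
  refine (HasDerivAt.fun_sum h).congr_deriv ?_
  simp only [weighted, map_sum, map_smul, Finset.smul_sum, smul_smul]
  rw [Finset.sum_comm]
  refine Finset.sum_congr rfl fun n _ => ?_
  have h2 : (a n * ((Real.exp ((l + F.ε n / H.ω) * η) * (l + F.ε n / H.ω) : ℝ) : ℂ)) •
      F.comp n l = ((H.ω : ℂ)⁻¹ * (a n * (Real.exp ((l + F.ε n / H.ω) * η) : ℂ))) •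
        (((F.ε n : ℂ) + l * H.ω) • F.comp n l) := by
    rw [smul_smul]
    congr 1
    push_cast
    field_simp
    ring
  rw [h2, comp_eigen, Finset.smul_sum]
  refine Finset.sum_congr rfl fun m _ => ?_
  congr 1
  rw [mul_left_comm (Real.exp (m * η) : ℂ), ← Complex.ofReal_mul, ← Real.exp_add]
  congr 4
  push_cast
  ring

/-- The weight grows at most like `e^{2|l|}` for `|η| ≤ 2`, and decay at rate `3` leaves rate `1`,
uniformly in `η`. -/
theorem exists_norm_weighted_le {α : ℝ} (hα : ∀ m, ‖H.coeff m‖ ≤ α) (a : Fin d → ℂ) :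
    ∃ B, 0 ≤ B ∧ ∀ (l : ℤ) (η : ℝ), |η| ≤ 2 →
      ‖F.weighted a η l‖ ≤ B * Real.exp (-(1 * |(l : ℝ)|)) := by
  choose C hC0 hC using F.exists_norm_comp_le hα
  refine ⟨∑ n, ‖a n‖ * Real.exp 1 * C n, Finset.sum_nonneg fun n _ => ?_, fun l η hη => ?_⟩
  · have := hC0 n
    positivity
  rw [Finset.sum_mul, weighted]
  refine norm_sum_le_of_le _ fun n _ => ?_
  rw [norm_smul, norm_mul, Complex.norm_real, Real.norm_eq_abs, Real.abs_exp]
  have h1 : (l + F.ε n / H.ω) * η ≤ 1 + 2 * |(l : ℝ)| := by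
    have h2 : |(l + F.ε n / H.ω) * η| ≤ (|(l : ℝ)| + 1 / 2) * 2 := by
      rw [abs_mul]
      gcongr
      exact (abs_add_le _ _).trans (by gcongr; exact F.abs_ε_div_ω_le n)
    linarith [le_abs_self ((l + F.ε n / H.ω) * η)]
  calc _ ≤ ‖a n‖ * Real.exp (1 + 2 * |(l : ℝ)|) * (C n * Real.exp (-(3 * |(l : ℝ)|))) := by
        gcongr
        exact hC n l
    _ = ‖a n‖ * C n * (Real.exp (1 + 2 * |(l : ℝ)|) * Real.exp (-(3 * |(l : ℝ)|))) := by ring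
    _ = ‖a n‖ * C n * (Real.exp 1 * Real.exp (-(1 * |(l : ℝ)|))) := by
        rw [← Real.exp_add, ← Real.exp_add]
        ring_nf
    _ = _ := by ring

/-- The squared norm of the continuation of a superposition to the imaginary time `iη/ω`. -/
def energy (a : Fin d → ℂ) (η : ℝ) : ℝ := ∑' l, ‖F.weighted a η l‖ ^ 2

theorem hasSum_energy {α : ℝ} (hα : ∀ m, ‖H.coeff m‖ ≤ α) (a : Fin d → ℂ) {η : ℝ}
    (hη : |η| ≤ 2) : HasSum (fun l => ‖F.weighted a η l‖ ^ 2) (F.energy a η) := by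
  obtain ⟨B, hB0, hB⟩ := F.exists_norm_weighted_le hα a
  refine Summable.hasSum (Summable.of_nonneg_of_le (fun l => by positivity) (fun l => ?_)
    ((summable_exp_neg_mul_abs (κ := 2) (by norm_num)).mul_left (B ^ 2)))
  calc ‖F.weighted a η l‖ ^ 2 ≤ (B * Real.exp (-(1 * |(l : ℝ)|))) ^ 2 := by
        gcongr
        exact hB l η hη
    _ = _ := by
        rw [mul_pow, ← Real.exp_nat_mul]
        congr 2
        push_cast
        ring

theorem norm_deriv_weighted_le {α : ℝ} (hα : ∀ m, ‖H.coeff m‖ ≤ α) (a : Fin d → ℂ) (η : ℝ)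
    (l : ℤ) : ‖(H.ω⁻¹ : ℂ) • ∑ m ∈ Finset.Icc (-(M : ℤ)) (M : ℤ),
        (Real.exp (m * η) : ℂ) • H.coeff m (F.weighted a η (l - m))‖ ≤
      α / H.ω * ∑ m ∈ Finset.Icc (-(M : ℤ)) (M : ℤ),
        Real.exp (m * η) * ‖F.weighted a η (l - m)‖ := by
  have hω := H.ω_pos
  rw [norm_smul, norm_inv, Complex.norm_real, Real.norm_eq_abs, abs_of_pos hω,
    div_eq_inv_mul, mul_assoc]
  gcongr
  rw [Finset.mul_sum]
  refine norm_sum_le_of_le _ fun m _ => ?_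
  rw [norm_smul, Complex.norm_real, Real.norm_eq_abs, Real.abs_exp, mul_left_comm]
  gcongr
  exact (H.coeff m).le_of_opNorm_le (hα m) _

/-- The Grönwall inequality. Uniform exponential bounds allow differentiation term by term. The
cross terms between modes `l` and `l - m` are split by `2xy ≤ x² + y²`, and both squares sum over
`l` to the energy. -/
theorem exists_hasDerivAt_energy {α : ℝ} (hα : ∀ m, ‖H.coeff m‖ ≤ α) (a : Fin d → ℂ) {η : ℝ}
    (hη : |η| < 2) : ∃ e', HasDerivAt (F.energy a) e' η ∧
      |e'| ≤ 2 * α / H.ω * ((2 * M + 1) * Real.cosh ((2 * M + 1) * η)) * F.energy a η := by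
  have hω := H.ω_pos
  have hα0 : 0 ≤ α := (norm_nonneg _).trans (hα 0)
  obtain ⟨B, hB0, hB⟩ := F.exists_norm_weighted_le hα a
  set u' : ℤ → ℝ → Phys d := fun l y => (H.ω⁻¹ : ℂ) • ∑ m ∈ Finset.Icc (-(M : ℤ)) (M : ℤ),
        (Real.exp (m * y) : ℂ) • H.coeff m (F.weighted a y (l - m)) with hu'
  set B' := α / H.ω * ∑ m ∈ Finset.Icc (-(M : ℤ)) (M : ℤ),
    Real.exp (3 * |(m : ℝ)|) * B with hB'
  have hu'_le : ∀ l y, |y| < 2 → ‖u' l y‖ ≤ B' * Real.exp (-(1 * |(l : ℝ)|)) := by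
    intro l y hy
    refine (F.norm_deriv_weighted_le hα a y l).trans ?_
    rw [hB', mul_assoc, Finset.sum_mul]
    refine mul_le_mul_of_nonneg_left (Finset.sum_le_sum fun m _ => ?_) (by positivity)
    have h1 : m * y ≤ 2 * |(m : ℝ)| := by
      have := le_abs_self ((m : ℝ) * y)
      rw [abs_mul] at this
      nlinarith [abs_nonneg (m : ℝ)]
    have h2 : |(l : ℝ)| - |(m : ℝ)| ≤ |((l - m : ℤ) : ℝ)| := by
      push_cast
      exact abs_sub_abs_le_abs_sub _ _
    calc _ ≤ Real.exp (2 * |(m : ℝ)|) * (B * Real.exp (-(1 * |((l - m : ℤ) : ℝ)|))) := by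
          gcongr
          exact hB _ _ hy.le
      _ ≤ Real.exp (2 * |(m : ℝ)|) * (B * Real.exp (-(1 * (|(l : ℝ)| - |(m : ℝ)|)))) := by gcongr
      _ = B * (Real.exp (2 * |(m : ℝ)|) * Real.exp (-(1 * (|(l : ℝ)| - |(m : ℝ)|)))) := by ring
      _ = B * (Real.exp (3 * |(m : ℝ)|) * Real.exp (-(1 * |(l : ℝ)|))) := by
          rw [← Real.exp_add, ← Real.exp_add]
          ring_nf
      _ = _ := by ring
  have hB'0 : 0 ≤ B' := by positivity
  have hball : ∀ y, y ∈ Set.Ioo (-2 : ℝ) 2 ↔ |y| < 2 := fun y => by rw [abs_lt, Set.mem_Ioo]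
  have hder : HasDerivAt (F.energy a) (∑' l, 2 * inner ℝ (F.weighted a η l) (u' l η)) η := by
    refine hasDerivAt_tsum_of_isPreconnected (t := Set.Ioo (-2 : ℝ) 2) (y₀ := 0)
      (g := fun l y => ‖F.weighted a y l‖ ^ 2)
      (g' := fun l y => 2 * inner ℝ (F.weighted a y l) (u' l y))
      (u := fun l : ℤ => 2 * B * B' * Real.exp (-(2 * |(l : ℝ)|)))
      ((summable_exp_neg_mul_abs (κ := 2) (by norm_num)).mul_left _)
      isOpen_Ioo isPreconnected_Ioo ?_ ?_ (by simp) ?_ ((hball η).2 hη)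
    · intro l y _
      exact (F.hasDerivAt_weighted a y l).norm_sq
    · intro l y hy
      rw [hball] at hy
      rw [norm_mul, Real.norm_eq_abs, Real.norm_eq_abs, abs_two]
      calc 2 * |inner ℝ (F.weighted a y l) (u' l y)|
          ≤ 2 * (‖F.weighted a y l‖ * ‖u' l y‖) := by
            gcongr
            exact abs_real_inner_le_norm _ _
        _ ≤ 2 * ((B * Real.exp (-(1 * |(l : ℝ)|))) * (B' * Real.exp (-(1 * |(l : ℝ)|)))) := by
            gcongr
            · exact hB l y hy.le
            · exact hu'_le l y hy
        _ = 2 * B * B' * (Real.exp (-(1 * |(l : ℝ)|)) * Real.exp (-(1 * |(l : ℝ)|))) := by ring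
        _ = _ := by
            rw [← Real.exp_add]
            ring_nf
    · exact (F.hasSum_energy hα a (by simp)).summable
  refine ⟨_, hder, ?_⟩
  have hs := F.hasSum_energy hα a hη.le
  have hm : ∀ m ∈ Finset.Icc (-(M : ℤ)) (M : ℤ), HasSum (fun l => Real.exp (m * η) *
      (‖F.weighted a η l‖ ^ 2 + ‖F.weighted a η (l - m)‖ ^ 2))
      (Real.exp (m * η) * (F.energy a η + F.energy a η)) := fun m _ =>
    (hs.add ((Equiv.subRight m).hasSum_iff.2 hs)).mul_left _
  have htot := (hasSum_sum hm).mul_left (α / H.ω)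
  have hb := tsum_of_norm_bounded (f := fun l => 2 * inner ℝ (F.weighted a η l) (u' l η)) htot ?_
  · rw [Real.norm_eq_abs, ← Finset.sum_mul] at hb
    refine hb.trans ?_
    have hE : 0 ≤ F.energy a η := tsum_nonneg fun l => by positivity
    have hsum := sum_exp_le_cosh M η
    calc _ = 2 * α / H.ω * (∑ m ∈ Finset.Icc (-(M : ℤ)) (M : ℤ), Real.exp (m * η)) *
          F.energy a η := by ring
      _ ≤ _ := by gcongr
  · intro l
    rw [norm_mul, Real.norm_eq_abs, Real.norm_eq_abs, abs_two]
    calc 2 * |inner ℝ (F.weighted a η l) (u' l η)|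
        ≤ 2 * (‖F.weighted a η l‖ * ‖u' l η‖) := by
          gcongr
          exact abs_real_inner_le_norm _ _
      _ ≤ 2 * (‖F.weighted a η l‖ * (α / H.ω * ∑ m ∈ Finset.Icc (-(M : ℤ)) (M : ℤ),
            Real.exp (m * η) * ‖F.weighted a η (l - m)‖)) := by
          gcongr
          exact F.norm_deriv_weighted_le hα a η l
      _ = α / H.ω * ∑ m ∈ Finset.Icc (-(M : ℤ)) (M : ℤ), Real.exp (m * η) *
            (2 * ‖F.weighted a η l‖ * ‖F.weighted a η (l - m)‖) := by
          simp only [Finset.mul_sum]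
          exact Finset.sum_congr rfl fun m _ => by ring
      _ ≤ _ := by
          gcongr with m hm
          exact two_mul_le_add_sq _ _

/-- The differential inequality makes energy times `exp(∓κ sinh(Dη))` monotone away from `0`. The
choice `|η| = 1/D` yields `sinh 1`. -/
theorem energy_le {α : ℝ} (hα : ∀ m, ‖H.coeff m‖ ≤ α) (a : Fin d → ℂ) {η : ℝ}
    (hη : |η| = 1 / (2 * M + 1)) :
    F.energy a η ≤ Real.exp (2 * α / H.ω * Real.sinh 1) * F.energy a 0 := by
  have hD : (1 : ℝ) ≤ 2 * M + 1 := by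
    have : (0 : ℝ) ≤ M := by positivity
    linarith
  have hη1 : |η| ≤ 1 := by
    rw [hη]
    exact (div_le_one (by linarith)).2 hD
  set D : ℝ := 2 * M + 1 with hDdef
  set κ := 2 * α / H.ω with hκ
  choose! e' he' hle using fun y (hy : |y| < 2) => F.exists_hasDerivAt_energy hα a hy
  have hsinh : ∀ y, HasDerivAt (fun y => κ * Real.sinh (D * y)) (κ * (D * Real.cosh (D * y))) y := by
    intro y
    have := (((hasDerivAt_id y).const_mul D).sinh).const_mul κ
    simpa [mul_comm, mul_left_comm] using this
  have hsinh_neg : ∀ y, HasDerivAt (fun y => -(κ * Real.sinh (D * y)))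
      (-(κ * (D * Real.cosh (D * y)))) y := fun y => (hsinh y).neg
  rcases le_total 0 η with h0 | h0
  · rw [abs_of_nonneg h0] at hη hη1
    have hb : ∀ y ∈ Set.Icc 0 η, |y| < 2 := fun y hy => by
      rw [abs_lt]; constructor <;> linarith [hy.1, hy.2]
    have hd : ∀ y ∈ Set.Icc 0 η, HasDerivAt
        (fun y => F.energy a y * Real.exp (-(κ * Real.sinh (D * y)))) _ y := fun y hy =>
      (he' y (hb y hy)).mul (hsinh_neg y).exp
    have hanti : AntitoneOn (fun y => F.energy a y * Real.exp (-(κ * Real.sinh (D * y))))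
        (Set.Icc 0 η) := by
      refine antitoneOn_of_hasDerivWithinAt_nonpos (convex_Icc _ _)
        (fun y hy => (hd y hy).continuousAt.continuousWithinAt)
        (fun y hy => (hd y (interior_subset hy)).hasDerivWithinAt) fun y hy => ?_
      have h1 := hle y (hb y (interior_subset hy))
      have h2 := le_abs_self (e' y)
      have h3 := Real.exp_pos (-(κ * Real.sinh (D * y)))
      nlinarith
    have h := hanti (Set.left_mem_Icc.2 h0) (Set.right_mem_Icc.2 h0) h0
    simp only [mul_zero, Real.sinh_zero, neg_zero, Real.exp_zero, mul_one] at h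
    have hDη : D * η = 1 := by rw [hη, mul_one_div_cancel (by linarith)]
    rw [hDη, Real.exp_neg, ← div_eq_mul_inv, div_le_iff₀ (Real.exp_pos _)] at h
    linarith
  · rw [abs_of_nonpos h0] at hη hη1
    have hb : ∀ y ∈ Set.Icc η 0, |y| < 2 := fun y hy => by
      rw [abs_lt]; constructor <;> linarith [hy.1, hy.2]
    have hd : ∀ y ∈ Set.Icc η 0, HasDerivAt
        (fun y => F.energy a y * Real.exp (κ * Real.sinh (D * y))) _ y := fun y hy =>
      (he' y (hb y hy)).mul (hsinh y).exp
    have hmono : MonotoneOn (fun y => F.energy a y * Real.exp (κ * Real.sinh (D * y)))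
        (Set.Icc η 0) := by
      refine monotoneOn_of_hasDerivWithinAt_nonneg (convex_Icc _ _)
        (fun y hy => (hd y hy).continuousAt.continuousWithinAt)
        (fun y hy => (hd y (interior_subset hy)).hasDerivWithinAt) fun y hy => ?_
      have h1 := hle y (hb y (interior_subset hy))
      have h2 := neg_abs_le (e' y)
      have h3 := Real.exp_pos (κ * Real.sinh (D * y))
      nlinarith
    have h := hmono (Set.left_mem_Icc.2 h0) (Set.right_mem_Icc.2 h0) h0
    simp only [mul_zero, Real.sinh_zero, Real.exp_zero, mul_one] at h
    have hDη : D * η = -1 := by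
      have : η = -(1 / D) := by linarith
      rw [this, mul_neg, mul_one_div_cancel (by linarith)]
    rw [hDη, Real.sinh_neg, mul_neg, Real.exp_neg, ← div_eq_mul_inv,
      div_le_iff₀ (Real.exp_pos _)] at h
    linarith

theorem energy_zero {α : ℝ} (hα : ∀ m, ‖H.coeff m‖ ≤ α) (a : Fin d → ℂ) :
    F.energy a 0 = ∑ n, ‖a n‖ ^ 2 := by
  have hs := F.hasSum_energy hα a (η := 0) (by simp)
  set x : Sambe d := ∑ n, a n • F.shifted n 0 with hx
  have hxl : ∀ l, x l = F.weighted a 0 l := by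
    intro l
    rw [hx, lp.coeFn_sum, Finset.sum_apply]
    simp [weighted, shifted_apply]
  have h1 := lp.hasSum_inner (𝕜 := ℂ) x x
  have h2 := hs.mapL Complex.ofRealCLM
  have h3 : inner ℂ x x = ((F.energy a 0 : ℝ) : ℂ) := by
    refine h1.unique (h2.congr_fun fun l => ?_)
    rw [inner_self_eq_norm_sq_to_K, hxl]
    simp
  have horth : Orthonormal ℂ (fun n => F.shifted n 0) :=
    F.orthonormal_shifted.comp (fun n => (n, (0 : ℤ))) fun n n' h => (Prod.mk.inj h).1
  rw [hx, horth.inner_sum] at h3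
  apply Complex.ofReal_injective
  rw [← h3]
  push_cast
  exact Finset.sum_congr rfl fun n _ => Complex.conj_mul' _

/-- A single mode is bounded by the whole energy at `|η| = 1/(2M+1)`, with the sign of `η` chosen so
that the weight `e^{lη}` is large. Allowing arbitrary `b` makes this an operator-norm bound
independent of `d`. -/
theorem norm_sum_comp_le {α : ℝ} (hα : ∀ m, ‖H.coeff m‖ ≤ α) (b : Phys d) (l : ℤ) :
    ‖∑ n, b n • F.comp n l‖ ≤
      Real.exp (1 / (2 * (2 * M + 1)) + Real.sinh 1 / (2 * Real.pi) * (α * H.T)) *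
        Real.exp (-(1 / (2 * M + 1))) ^ l.natAbs * ‖b‖ := by
  have hω := H.ω_pos
  have hD : (0 : ℝ) < 2 * M + 1 := by positivity
  obtain ⟨η, hη, hl⟩ : ∃ η : ℝ, |η| = 1 / (2 * M + 1) ∧ l * η = |(l : ℝ)| / (2 * M + 1) := by
    have h : |1 / (2 * (M : ℝ) + 1)| = 1 / (2 * M + 1) := abs_of_pos (by positivity)
    rcases le_total 0 (l : ℝ) with h0 | h0
    · exact ⟨1 / (2 * M + 1), h, by rw [abs_of_nonneg h0]; ring⟩
    · exact ⟨-(1 / (2 * M + 1)), by rw [abs_neg, h], by rw [abs_of_nonpos h0]; ring⟩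
  -- These coefficients cancel the quasienergy part of the weight, leaving the common factor
  -- `e^{lη}`. As `|ε_n/ω| ≤ 1/2`, the cost in norm is at most `exp(1/(2(2M+1)))`.
  set a : Fin d → ℂ := fun n => b n * (Real.exp (-(F.ε n / H.ω * η)) : ℂ) with ha
  have hη2 : |η| ≤ 2 := by
    rw [hη, div_le_iff₀ hD]
    have : (0 : ℝ) ≤ M := by positivity
    linarith
  have hw : F.weighted a η l = (Real.exp (l * η) : ℂ) • ∑ n, b n • F.comp n l := by
    rw [weighted, Finset.smul_sum]
    refine Finset.sum_congr rfl fun n _ => ?_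
    rw [smul_smul, ha]
    congr 1
    simp only
    rw [mul_assoc, ← Complex.ofReal_mul, ← Real.exp_add, mul_comm]
    congr 3
    ring
  have h1 : ‖F.weighted a η l‖ ^ 2 ≤ F.energy a η :=
    le_hasSum (F.hasSum_energy hα a hη2) l fun _ _ => by positivity
  have h2 := F.energy_le hα a hη
  have h3 : F.energy a 0 ≤ Real.exp (1 / (2 * M + 1)) * ‖b‖ ^ 2 := by
    rw [F.energy_zero hα, EuclideanSpace.norm_sq_eq, Finset.mul_sum]
    refine Finset.sum_le_sum fun n _ => ?_
    rw [ha, norm_mul, mul_pow, Complex.norm_real, Real.norm_eq_abs, Real.abs_exp,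
      ← Real.exp_nat_mul, mul_comm]
    gcongr
    have h4 : |F.ε n / H.ω * η| ≤ 1 / 2 * (1 / (2 * M + 1)) := by
      rw [abs_mul, hη]
      gcongr
      exact F.abs_ε_div_ω_le n
    have := neg_abs_le (F.ε n / H.ω * η)
    push_cast
    linarith
  have h5 : (Real.exp (l * η) * ‖∑ n, b n • F.comp n l‖) ^ 2 ≤
      (Real.exp (1 / (2 * (2 * M + 1)) + Real.sinh 1 / (2 * Real.pi) * (α * H.T)) * ‖b‖) ^ 2 := by
    have h6 : Real.exp (l * η) * ‖∑ n, b n • F.comp n l‖ = ‖F.weighted a η l‖ := by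
      rw [hw, norm_smul, Complex.norm_real, Real.norm_eq_abs, Real.abs_exp]
    rw [h6]
    refine (h1.trans (h2.trans (mul_le_mul_of_nonneg_left h3 (Real.exp_pos _).le))).trans_eq ?_
    rw [mul_pow, ← mul_assoc, ← Real.exp_add, ← Real.exp_nat_mul]
    congr 2
    have hT := H.T_pos.ne'
    have hπ := Real.pi_ne_zero
    rw [PeriodicHamiltonian.ω]
    push_cast
    field_simp
    ring
  have h7 := le_of_sq_le_sq h5 (by positivity)
  rw [← exp_neg_mul_abs_eq_pow, mul_right_comm]
  have h8 : Real.exp (-(1 / (2 * M + 1) * |(l : ℝ)|)) = (Real.exp (l * η))⁻¹ := by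
    rw [← Real.exp_neg, hl]
    congr 1
    ring
  rw [h8, ← div_eq_mul_inv, le_div_iff₀ (Real.exp_pos _), mul_comm]
  exact h7

end FloquetBasis

end Floquet

end

noncomputable section

/-! ### Fourier inversion, duality and normalisation -/

namespace Floquet

variable {d M : ℕ}

theorem PeriodicHamiltonian.hasSum_fourierComp (H : PeriodicHamiltonian d M) {g : ℝ → ℂ}
    (hg : Continuous g) (hp : Function.Periodic g H.T) (hs : Summable (H.fourierComp g)) :
    HasSum (H.fourierComp g) (g 0) := by
  have : Fact (0 < H.T) := ⟨H.T_pos⟩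
  let f : C(AddCircle H.T, ℂ) := ⟨hp.lift, continuous_coinduced_dom.2 hg⟩
  have hf : ∀ t : ℝ, f (t : AddCircle H.T) = g t := fun t => hp.lift_coe t
  have hc : ∀ i, fourierCoeff f i = H.fourierComp g (-i) := by
    intro i
    rw [fourierCoeff_eq_intervalIntegral _ _ 0, PeriodicHamiltonian.fourierComp, zero_add, one_div]
    congr 1
    refine intervalIntegral.integral_congr fun t _ => ?_
    simp only [hf]
    congr 1
    rw [fourier_coe_apply]
    congr 1
    simp only [PeriodicHamiltonian.ω]
    push_cast
    ring
  have hs' : Summable (fourierCoeff f) := by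
    have := (Equiv.neg ℤ).summable_iff.2 hs
    exact this.congr fun i => by simp [hc]
  have h := has_pointwise_sum_fourier_series_of_summable hs' ((0 : ℝ) : AddCircle H.T)
  rw [hf] at h
  have h' := (Equiv.neg ℤ).hasSum_iff.2 h
  refine h'.congr_fun fun i => ?_
  simp [hc]

/-- Duality: the hypothesis bounds `b ↦ ∑ b_n w_n`, and the conclusion is the same bound for its
adjoint. It follows by testing on `b_n = ⟨w_n, v⟩`. -/
theorem sum_norm_sq_inner_le {w : Fin d → Phys d} {K : ℝ}
    (hw : ∀ b : Phys d, ‖∑ n, b n • w n‖ ≤ K * ‖b‖) (v : Phys d) :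
    ∑ n, ‖inner ℂ (w n) v‖ ^ 2 ≤ (K * ‖v‖) ^ 2 := by
  set b : Phys d := WithLp.toLp 2 fun n => inner ℂ (w n) v with hb
  have hbb : ‖b‖ ^ 2 = ∑ n, ‖inner ℂ (w n) v‖ ^ 2 := EuclideanSpace.norm_sq_eq b
  have h1 : inner ℂ (∑ n, b n • w n) v = ((‖b‖ ^ 2 : ℝ) : ℂ) := by
    rw [hbb, sum_inner]
    push_cast
    exact Finset.sum_congr rfl fun n _ => by rw [inner_smul_left, Complex.conj_mul']
  have h2 : ‖b‖ ^ 2 ≤ K * ‖b‖ * ‖v‖ := by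
    have h3 := norm_inner_le_norm (𝕜 := ℂ) (∑ n, b n • w n) v
    rw [h1, Complex.norm_real, Real.norm_eq_abs, abs_of_nonneg (by positivity)] at h3
    exact h3.trans (mul_le_mul_of_nonneg_right (hw b) (norm_nonneg _))
  rw [← hbb]
  rcases (norm_nonneg b).eq_or_lt with h0 | h0
  · rw [← h0, zero_pow two_ne_zero]
    exact sq_nonneg _
  · have h4 : ‖b‖ ≤ K * ‖v‖ := by
      refine le_of_mul_le_mul_left ?_ h0
      linarith
    gcongr

/-- A vector whose norm is close to `1/2` and which is close to the range of an operator fixing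
its own range is close to half of a unit vector of that range. -/
theorem exists_unit_near {E : Type*} [NormedAddCommGroup E] [NormedSpace ℂ E] (P : E →L[ℂ] E)
    (R : E) (hP : P (P R) = P R) {e : E} (he : ‖e‖ = 1) (hPe : P e = e) :
    ∃ u : E, ‖u‖ = 1 ∧ P u = u ∧
      ‖R - (1 / 2 : ℝ) • u‖ ≤ 2 * ‖R - P R‖ + |‖R‖ - 1 / 2| := by
  have hsuff : ∀ u : E, P R = ‖P R‖ • u → ‖u‖ = 1 →
      ‖R - (1 / 2 : ℝ) • u‖ ≤ 2 * ‖R - P R‖ + |‖R‖ - 1 / 2| := by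
    intro u hu hu1
    have h1 : ‖P R - (1 / 2 : ℝ) • u‖ = |‖P R‖ - 1 / 2| := by
      nth_rewrite 1 [hu]
      rw [← sub_smul, norm_smul, hu1, mul_one, Real.norm_eq_abs]
    have h2 : R - (1 / 2 : ℝ) • u = (R - P R) + (P R - (1 / 2 : ℝ) • u) := by abel
    have h3 : |‖P R‖ - 1 / 2| ≤ |‖P R‖ - ‖R‖| + |‖R‖ - 1 / 2| := abs_sub_le _ _ _
    have h4 : |‖P R‖ - ‖R‖| ≤ ‖R - P R‖ := by
      rw [norm_sub_rev]
      exact abs_norm_sub_norm_le _ _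
    have h5 := norm_add_le (R - P R) (P R - (1 / 2 : ℝ) • u)
    rw [h2]
    linarith
  by_cases h0 : P R = 0
  -- When `P R = 0` there is nothing to normalise, and any unit vector fixed by `P` serves.
  · exact ⟨e, he, hPe, hsuff e (by simp [h0]) he⟩
  · have hn : ‖P R‖ ≠ 0 := norm_ne_zero_iff.2 h0
    have hu1 : ‖(‖P R‖⁻¹ : ℝ) • P R‖ = 1 := by
      rw [norm_smul, norm_inv, norm_norm, inv_mul_cancel₀ hn]
    refine ⟨(‖P R‖⁻¹ : ℝ) • P R, hu1, ?_, hsuff _ ?_ hu1⟩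
    · rw [ContinuousLinearMap.map_smul_of_tower, hP]
    · rw [smul_smul, mul_inv_cancel₀ hn, one_smul]

theorem coe_smul_sambe (c : ℝ) (x : Sambe d) : (c : ℂ) • x = c • x := by
  ext l j
  rfl

theorem card_window (K : ℕ) : (window K).card = 2 * K := by
  rw [window, Int.card_Ioc]
  omega

theorem mem_window {K : ℕ} {l : ℤ} : l ∈ window K ↔ -(K : ℤ) < l ∧ l ≤ K := Finset.mem_Ioc

/-! ### Tails of the Fourier series at time zero -/

namespace FloquetBasis

variable {H : PeriodicHamiltonian d M} (F : FloquetBasis H)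

/-- The base `e^{-1/(2M+1)}` of the exponential decay of the Fourier components. -/
def decayRate (M : ℕ) : ℝ := Real.exp (-(1 / (2 * M + 1)))

theorem decayRate_pos (M : ℕ) : 0 < decayRate M := Real.exp_pos _

theorem decayRate_lt_one (M : ℕ) : decayRate M < 1 := by
  rw [decayRate, Real.exp_lt_one_iff]
  have : (0 : ℝ) < 1 / (2 * M + 1) := by positivity
  linarith

/-- The prefactor of the exponential decay of the Fourier components. -/
def decayConst (M : ℕ) (x : ℝ) : ℝ :=
  Real.exp (1 / (2 * (2 * M + 1)) + Real.sinh 1 / (2 * Real.pi) * x)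

theorem decayConst_pos (M : ℕ) (x : ℝ) : 0 < decayConst M x := Real.exp_pos _

/-- The bound on the sum of all Fourier components of index at least `k` in absolute value. -/
def tailBound (M : ℕ) (x : ℝ) (k : ℕ) : ℝ :=
  decayConst M x * (2 * decayRate M ^ k / (1 - decayRate M))

theorem tailBound_nonneg (M : ℕ) (x : ℝ) (k : ℕ) : 0 ≤ tailBound M x k := by
  have h1 := decayRate_lt_one M
  have h2 := decayRate_pos M
  have h3 := decayConst_pos M x
  have h4 : 0 < 1 - decayRate M := by linarith
  unfold tailBound
  positivity

variable {α : ℝ}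

theorem norm_sum_sum_comp_le (hα : ∀ m, ‖H.coeff m‖ ≤ α) (b : Phys d) {k : ℕ} {J : Finset ℤ}
    (hJ : ∀ j ∈ J, k ≤ j.natAbs) :
    ‖∑ n, b n • ∑ j ∈ J, F.comp n j‖ ≤ tailBound M (α * H.T) k * ‖b‖ := by
  simp only [Finset.smul_sum]
  rw [Finset.sum_comm]
  calc ‖∑ j ∈ J, ∑ n, b n • F.comp n j‖
      ≤ ∑ j ∈ J, decayConst M (α * H.T) * decayRate M ^ j.natAbs * ‖b‖ :=
        norm_sum_le_of_le _ fun j _ => F.norm_sum_comp_le hα b j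
    _ = decayConst M (α * H.T) * (∑ j ∈ J, decayRate M ^ j.natAbs) * ‖b‖ := by
        rw [← Finset.sum_mul, ← Finset.mul_sum]
    _ ≤ _ := by
        unfold tailBound
        have := (decayConst_pos M (α * H.T)).le
        gcongr
        exact sum_pow_natAbs_le (decayRate_pos M).le (decayRate_lt_one M) hJ

theorem norm_comp_le (hα : ∀ m, ‖H.coeff m‖ ≤ α) (n : Fin d) (l : ℤ) :
    ‖F.comp n l‖ ≤ decayConst M (α * H.T) * decayRate M ^ l.natAbs := by
  have h := F.norm_sum_comp_le hα (EuclideanSpace.single n 1) l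
  simpa [decayConst, decayRate, Finset.sum_ite_eq, Pi.single_apply, ite_smul] using h

theorem hasSum_comp (hα : ∀ m, ‖H.coeff m‖ ≤ α) (n : Fin d) : HasSum (F.comp n) (F.φ n 0) := by
  have hs : Summable (F.comp n) := Summable.of_norm_bounded
    ((summable_pow_natAbs (decayRate_pos M).le (decayRate_lt_one M)).mul_left _)
    (F.norm_comp_le hα n)
  have hφ := F.continuous_φ n
  convert hs.hasSum using 1
  ext j
  have h1 := hs.hasSum.mapL (EuclideanSpace.proj j : Phys d →L[ℂ] ℂ)
  have hc : ∀ l, (EuclideanSpace.proj j : Phys d →L[ℂ] ℂ) (F.comp n l) =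
      H.fourierComp (fun t => F.φ n t j) l := fun l =>
    H.map_fourierComp (EuclideanSpace.proj j : Phys d →L[ℂ] ℂ) hφ l
  simp only [hc] at h1
  exact (H.hasSum_fourierComp (g := fun t => F.φ n t j) (by fun_prop)
    (fun t => by simp only [F.periodic]) h1.summable).unique h1

/-- The components sum to `φ_n(0)`, so the difference is a limit of finite sums over indices outside
`J`, all at least `k` in absolute value. -/
theorem norm_sum_φ_sub_le (hα : ∀ m, ‖H.coeff m‖ ≤ α) (b : Phys d) {k : ℕ} {J : Finset ℤ}
    (hJ : ∀ j : ℤ, j.natAbs < k → j ∈ J) :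
    ‖∑ n, b n • (F.φ n 0 - ∑ j ∈ J, F.comp n j)‖ ≤ tailBound M (α * H.T) k * ‖b‖ := by
  have h : Filter.Tendsto (fun S : Finset ℤ => ‖∑ n, b n • (∑ j ∈ S, F.comp n j -
      ∑ j ∈ J, F.comp n j)‖) Filter.atTop
      (nhds ‖∑ n, b n • (F.φ n 0 - ∑ j ∈ J, F.comp n j)‖) := by
    refine Filter.Tendsto.norm (tendsto_finsetSum _ fun n _ => ?_)
    exact ((F.hasSum_comp hα n).sub_const _).const_smul _
  refine le_of_tendsto h ?_
  filter_upwards [Filter.eventually_ge_atTop J] with S hS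
  have : ∀ n, ∑ j ∈ S, F.comp n j - ∑ j ∈ J, F.comp n j = ∑ j ∈ S \ J, F.comp n j := fun n =>
    (Finset.sum_sdiff_eq_sub hS).symm
  simp only [this]
  refine F.norm_sum_sum_comp_le hα b fun j hj => ?_
  by_contra hlt
  exact (Finset.mem_sdiff.1 hj).2 (hJ j (not_le.1 hlt))

theorem norm_φ (n : Fin d) (t : ℝ) : ‖F.φ n t‖ = 1 := (F.orthonormal t).1 n

/-- The Fourier indices seen from `l` through the window `[4L]` of the initial state. -/
def overlap (L : ℕ) (l : ℤ) : Finset ℤ := (window (4 * L)).image fun k => k - l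

theorem mem_overlap {L : ℕ} {l j : ℤ} :
    j ∈ overlap L l ↔ -(4 * L : ℤ) < j + l ∧ j + l ≤ 4 * L := by
  simp only [overlap, Finset.mem_image, mem_window]
  constructor
  · rintro ⟨k, hk, rfl⟩
    push_cast at hk
    omega
  · intro h
    refine ⟨j + l, ?_, by ring⟩
    push_cast
    exact h

/-! ### Overlaps with the shifted eigenstates and the norm of the residual -/

theorem inner_shifted_initial (L : ℕ) (n n' : Fin d) (l : ℤ) :
    inner ℂ (F.shifted n' l) (F.initial L n) =
      ((1 / Real.sqrt (8 * L) : ℝ) : ℂ) *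
        inner ℂ (∑ j ∈ overlap L l, F.comp n' j) (F.φ n 0) := by
  rw [initial, ← coe_smul_sambe, inner_smul_right, inner_sum, sum_inner, overlap,
    Finset.sum_image (by intro x _ y _ h; simpa using h)]
  congr 1
  refine Finset.sum_congr rfl fun k _ => ?_
  rw [lp.inner_single_right, shifted_apply]

theorem inner_shifted_shifted (n n' : Fin d) (l l' : ℤ) :
    inner ℂ (F.shifted n l) (F.shifted n' l') = if n = n' ∧ l = l' then (1 : ℂ) else 0 := by
  have := orthonormal_iff_ite.1 F.orthonormal_shifted (n, l) (n', l')
  simpa using this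

theorem inner_shifted_mainTerm (L : ℕ) (n n' : Fin d) (l : ℤ) :
    inner ℂ (F.shifted n' l) (F.mainTerm L n) =
      ((1 / Real.sqrt (8 * L) : ℝ) : ℂ) * if n' = n ∧ l ∈ window (3 * L) then 1 else 0 := by
  rw [mainTerm, ← coe_smul_sambe, inner_smul_right, inner_sum]
  simp only [inner_shifted_shifted]
  congr 1
  by_cases hn : n' = n <;> simp [hn]

theorem inv_sqrt_sq {L : ℕ} (hL : 1 ≤ L) : (1 / Real.sqrt (8 * L)) ^ 2 = 1 / (8 * L) := by
  rw [div_pow, one_pow, Real.sq_sqrt (by positivity)]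

theorem norm_initial {L : ℕ} (hL : 1 ≤ L) (n : Fin d) : ‖F.initial L n‖ ^ 2 = 1 := by
  have hL' : (0 : ℝ) < L := by exact_mod_cast hL
  have h := lp.norm_sum_single (p := 2) (by norm_num) (fun _ : ℤ => F.φ n 0) (window (4 * L))
  simp only [norm_φ, ENNReal.toReal_ofNat, Real.rpow_ofNat, one_pow, Finset.sum_const,
    card_window, nsmul_eq_mul, mul_one] at h
  rw [initial, norm_smul, mul_pow, h, Real.norm_eq_abs, sq_abs, inv_sqrt_sq hL]
  push_cast
  field_simp
  norm_num

theorem norm_mainTerm {L : ℕ} (hL : 1 ≤ L) (n : Fin d) : ‖F.mainTerm L n‖ ^ 2 = 3 / 4 := by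
  have hL' : (0 : ℝ) < L := by exact_mod_cast hL
  have h : ‖∑ l ∈ window (3 * L), F.shifted n l‖ ^ 2 = 6 * L := by
    have h1 : inner ℂ (∑ l ∈ window (3 * L), F.shifted n l)
        (∑ l ∈ window (3 * L), F.shifted n l) = ((6 * L : ℝ) : ℂ) := by
      simp only [sum_inner, inner_sum, inner_shifted_shifted, true_and, Finset.sum_ite_eq']
      rw [Finset.sum_congr rfl fun l hl => if_pos hl, Finset.sum_const, card_window]
      simp
      ring
    rw [inner_self_eq_norm_sq_to_K] at h1
    exact Complex.ofReal_injective (by push_cast at h1 ⊢; exact h1)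
  rw [mainTerm, norm_smul, mul_pow, h, Real.norm_eq_abs, sq_abs, inv_sqrt_sq hL]
  field_simp
  norm_num

theorem norm_inner_sub_le (hα : ∀ m, ‖H.coeff m‖ ≤ α) (n : Fin d) {k : ℕ} {J : Finset ℤ}
    (hJ : ∀ j : ℤ, j.natAbs < k → j ∈ J) :
    ‖inner ℂ (F.φ n 0 - ∑ j ∈ J, F.comp n j) (F.φ n 0)‖ ≤ tailBound M (α * H.T) k := by
  have h := F.norm_sum_φ_sub_le hα (EuclideanSpace.single n 1) hJ
  simp only [PiLp.single_apply, ite_smul, one_smul, zero_smul, Finset.sum_ite_eq',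
    Finset.mem_univ, if_true, PiLp.norm_single, norm_one, mul_one] at h
  refine (norm_inner_le_norm _ _).trans ?_
  rwa [norm_φ, mul_one]

/-- Expanding the square gives `1 + 3/4 - 2 Re⟨main, initial⟩`. The deviation from `1/4` is an
average of the `6L` truncation errors `τ l`. -/
theorem abs_norm_residual_sq_sub_le (hα : ∀ m, ‖H.coeff m‖ ≤ α) {L : ℕ} (hL : 1 ≤ L)
    (n : Fin d) :
    |‖F.initial L n - F.mainTerm L n‖ ^ 2 - 1 / 4| ≤
      3 / 2 * tailBound M (α * H.T) (L + 1) := by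
  have hL' : (0 : ℝ) < L := by exact_mod_cast hL
  set β : ℝ := 1 / Real.sqrt (8 * L) with hβ
  have hβ2 : β ^ 2 = 1 / (8 * L) := inv_sqrt_sq hL
  set τ : ℤ → ℂ := fun l => inner ℂ (F.φ n 0 - ∑ j ∈ overlap L l, F.comp n j) (F.φ n 0) with hτ
  -- For `l ∈ [3L]`, every index with `|j| ≤ L` is seen through `[4L]`, hence the tail from `L + 1`.
  have hτle : ∀ l ∈ window (3 * L), ‖τ l‖ ≤ tailBound M (α * H.T) (L + 1) := by
    intro l hl
    refine F.norm_inner_sub_le hα n fun j hj => ?_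
    rw [mem_window] at hl
    rw [mem_overlap]
    push_cast at hl
    omega
  have hin : ∀ l, inner ℂ (F.shifted n l) (F.initial L n) = (β : ℂ) * (1 - τ l) := by
    intro l
    rw [inner_shifted_initial, hτ]
    simp only
    rw [inner_sub_left, inner_self_eq_norm_sq_to_K, norm_φ, ← hβ]
    congr 1
    simp only [RCLike.ofReal_one, one_pow, sub_sub_cancel]
  have hmain : inner ℂ (F.mainTerm L n) (F.initial L n) =
      ((3 / 4 : ℝ) : ℂ) - ((1 / (8 * L) : ℝ) : ℂ) * ∑ l ∈ window (3 * L), τ l := by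
    have h3 : ((3 / 4 : ℝ) : ℂ) = ((1 / (8 * L) : ℝ) : ℂ) * (2 * (3 * L) : ℕ) := by
      rw [← Complex.ofReal_natCast, ← Complex.ofReal_mul]
      congr 1
      push_cast
      field_simp
      norm_num
    rw [mainTerm, ← coe_smul_sambe, inner_smul_left, Complex.conj_ofReal, sum_inner, h3,
      ← mul_sub, ← hβ2, ← hβ]
    simp only [hin]
    rw [← Finset.mul_sum, Finset.sum_sub_distrib, Finset.sum_const, card_window]
    push_cast
    simp
    ring
  have hre : ‖F.initial L n - F.mainTerm L n‖ ^ 2 - 1 / 4 =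
      2 * (1 / (8 * L)) * (∑ l ∈ window (3 * L), τ l).re := by
    rw [@norm_sub_sq ℂ, norm_initial F hL, norm_mainTerm F hL, ← inner_conj_symm, hmain]
    rw [RCLike.conj_re]
    simp only [RCLike.re_to_complex, Complex.sub_re, Complex.ofReal_re, Complex.re_ofReal_mul]
    ring
  rw [hre, abs_mul, abs_of_nonneg (by positivity)]
  have hsum : ‖∑ l ∈ window (3 * L), τ l‖ ≤ 6 * L * tailBound M (α * H.T) (L + 1) := by
    refine (norm_sum_le_of_le _ hτle).trans_eq ?_
    rw [Finset.sum_const, card_window, nsmul_eq_mul]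
    push_cast
    ring
  calc _ ≤ 2 * (1 / (8 * (L : ℝ))) * (6 * L * tailBound M (α * H.T) (L + 1)) := by
        gcongr
        exact (Complex.abs_re_le_norm _).trans hsum
    _ = _ := by
        field_simp
        ring

theorem tailBound_succ_le (M : ℕ) (x : ℝ) (L : ℕ) :
    3 * tailBound M x (L + 1) ≤ 27 * (2 * (M : ℝ) + 1) *
      Real.exp (-((L : ℝ) / (2 * (M : ℝ) + 1)) + Real.sinh 1 / (2 * Real.pi) * x) := by
  have hM : (0 : ℝ) ≤ M := by positivity
  have hD : (0 : ℝ) < 2 * M + 1 := by positivity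
  have h1 := decayRate_lt_one M
  have h0 := decayRate_pos M
  -- Equivalent to `e^{1/D} ≥ 1 + 1/D` with `D = 2M+1`. The extra power of the rate in the tail from
  -- `L + 1` supplies the numerator.
  have hr : decayRate M / (1 - decayRate M) ≤ 2 * M + 1 := by
    rw [div_le_iff₀ (by linarith)]
    have h2 : 1 / (2 * (M : ℝ) + 1) + 1 ≤ (decayRate M)⁻¹ := by
      rw [decayRate, ← Real.exp_neg, neg_neg]
      exact Real.add_one_le_exp _
    have h3 := mul_le_mul_of_nonneg_left h2 h0.le
    rw [mul_inv_cancel₀ h0.ne'] at h3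
    have h4 := mul_le_mul_of_nonneg_left h3 hD.le
    have h5 : (2 * (M : ℝ) + 1) * (decayRate M * (1 / (2 * (M : ℝ) + 1) + 1)) =
        decayRate M + (2 * M + 1) * decayRate M := by
      field_simp
    linarith
  have hpow : decayRate M ^ L = Real.exp (-((L : ℝ) / (2 * (M : ℝ) + 1))) := by
    rw [decayRate, ← Real.exp_nat_mul]
    congr 1
    ring
  -- The factor `exp(1/(2(2M+1)))` is bounded crudely by `e`, and `6e < 27`.
  have hconst : decayConst M x ≤ 2.7182818286 * Real.exp (Real.sinh 1 / (2 * Real.pi) * x) := by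
    rw [decayConst, Real.exp_add]
    gcongr
    refine le_trans (Real.exp_le_exp.2 ?_) Real.exp_one_lt_d9.le
    rw [div_le_one (by positivity)]
    linarith
  have hpos : 0 < 1 - decayRate M := by linarith
  calc 3 * tailBound M x (L + 1)
      = 6 * decayConst M x * decayRate M ^ L * (decayRate M / (1 - decayRate M)) := by
        unfold tailBound
        ring
    _ ≤ 6 * (2.7182818286 * Real.exp (Real.sinh 1 / (2 * Real.pi) * x)) * decayRate M ^ L *
          (2 * M + 1) := by gcongr
    _ ≤ 27 * (2 * (M : ℝ) + 1) *
        (decayRate M ^ L * Real.exp (Real.sinh 1 / (2 * Real.pi) * x)) := by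
        have : 0 < (2 * (M : ℝ) + 1) *
          (decayRate M ^ L * Real.exp (Real.sinh 1 / (2 * Real.pi) * x)) := by positivity
        nlinarith
    _ = _ := by rw [hpow, Real.exp_add]

theorem abs_norm_residual_sub_half_le (hα : ∀ m, ‖H.coeff m‖ ≤ α) {L : ℕ} (hL : 1 ≤ L)
    (n : Fin d) :
    |‖F.initial L n - F.mainTerm L n‖ - 1 / 2| ≤ 27 * (2 * (M : ℝ) + 1) *
      Real.exp (-((L : ℝ) / (2 * (M : ℝ) + 1)) + Real.sinh 1 / (2 * Real.pi) * (α * H.T)) := by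
  refine le_trans ?_ (tailBound_succ_le M (α * H.T) L)
  have h := F.abs_norm_residual_sq_sub_le hα hL n
  set x := ‖F.initial L n - F.mainTerm L n‖
  have hx : 0 ≤ x := norm_nonneg _
  have h2 : |x ^ 2 - 1 / 4| = |x - 1 / 2| * (x + 1 / 2) := by
    have h4 : x ^ 2 - 1 / 4 = (x - 1 / 2) * (x + 1 / 2) := by ring
    rw [h4, abs_mul, abs_of_nonneg (by linarith : 0 ≤ x + 1 / 2)]
  have h3 := abs_nonneg (x - 1 / 2)
  -- Since `x + 1/2 ≥ 1/2`, passing from `x²` to `x` costs a factor `2`, which turns `3/2` into `3`.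
  nlinarith

/-! ### The projection and the part of the residual it misses -/

theorem highProj_apply (L : ℕ) (x : Sambe d) : F.highProj L x =
    ∑ n : Fin d, ∑ l ∈ window (6 * L) \ window (L + 1),
      inner ℂ (F.shifted n l) x • F.shifted n l := by
  simp [highProj, sum_apply, InnerProductSpace.rankOne_apply]

theorem inner_shifted_highProj (L : ℕ) (x : Sambe d) (n : Fin d) (l : ℤ) :
    inner ℂ (F.shifted n l) (F.highProj L x) =
      if l ∈ window (6 * L) \ window (L + 1) then inner ℂ (F.shifted n l) x else 0 := by
  rw [highProj_apply, inner_sum]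
  simp only [inner_sum, inner_smul_right, inner_shifted_shifted]
  rw [Finset.sum_eq_single n]
  · simp
  · intro n' _ hn
    simp [hn.symm]
  · simp

theorem highProj_highProj (L : ℕ) (x : Sambe d) :
    F.highProj L (F.highProj L x) = F.highProj L x := by
  rw [highProj_apply, highProj_apply]
  refine Finset.sum_congr rfl fun n _ => Finset.sum_congr rfl fun l hl => ?_
  rw [← highProj_apply, inner_shifted_highProj, if_pos hl]

theorem highProj_shifted {L : ℕ} (n : Fin d) {l : ℤ} (hl : l ∈ window (6 * L) \ window (L + 1)) :
    F.highProj L (F.shifted n l) = F.shifted n l := by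
  rw [highProj_apply, Finset.sum_eq_single n]
  · simp only [inner_shifted_shifted, true_and, ite_smul, one_smul, zero_smul]
    rw [Finset.sum_ite_eq' _ l, if_pos hl]
  · intro n' _ hn
    simp [inner_shifted_shifted, hn]
  · simp

/-- The square root `e^{-1/(2(2M+1))}` of the decay rate. -/
def halfRate (M : ℕ) : ℝ := Real.exp (-(1 / (2 * (2 * M + 1))))

theorem halfRate_sq (M : ℕ) : halfRate M ^ 2 = decayRate M := by
  rw [halfRate, decayRate, ← Real.exp_nat_mul]
  congr 1
  push_cast
  field_simp

theorem halfRate_pos (M : ℕ) : 0 < halfRate M := Real.exp_pos _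

theorem halfRate_lt_one (M : ℕ) : halfRate M < 1 := by
  rw [halfRate, Real.exp_lt_one_iff]
  have : (0 : ℝ) < 1 / (2 * (2 * M + 1)) := by positivity
  linarith

/-- The squared tail carries `halfRate M ^ (4 * k)`. Part of this exponent provides the decay in
`L`, and the part `i = |l|` keeps the bound summable over shifts. -/
theorem tailBound_sq_le (M : ℕ) (x : ℝ) {k L i : ℕ} (h : 2 * L + i ≤ 4 * k) :
    tailBound M x k ^ 2 ≤ (tailBound M x 0 * halfRate M ^ L) ^ 2 * halfRate M ^ i := by
  have h0 := halfRate_pos M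
  have h1 := tailBound_nonneg M x 0
  have hk : tailBound M x k = tailBound M x 0 * halfRate M ^ (2 * k) := by
    unfold tailBound
    rw [pow_mul, halfRate_sq]
    ring
  have hp : halfRate M ^ (4 * k) ≤ halfRate M ^ (2 * L + i) :=
    pow_le_pow_of_le_one h0.le (halfRate_lt_one M).le h
  calc tailBound M x k ^ 2 = tailBound M x 0 ^ 2 * halfRate M ^ (4 * k) := by
        rw [hk, mul_pow, ← pow_mul]
        ring_nf
    _ ≤ tailBound M x 0 ^ 2 * halfRate M ^ (2 * L + i) := by gcongr
    _ = _ := by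
        rw [pow_add]
        ring

/-- The projection removes the shifts in `[6L] ∖ [L+1]`. In `[L+1]` the coefficients of initial
state and main term agree up to a Fourier tail. Outside `[6L]` the main term has none, and that of
the initial state is itself a tail. -/
theorem sum_norm_sq_inner_residual_le (hα : ∀ m, ‖H.coeff m‖ ≤ α) {L : ℕ} (hL : 1 ≤ L)
    (n : Fin d) (l : ℤ) :
    ∑ n', ‖inner ℂ (F.shifted n' l) ((F.initial L n - F.mainTerm L n) -
      F.highProj L (F.initial L n - F.mainTerm L n))‖ ^ 2 ≤
      (tailBound M (α * H.T) 0 * halfRate M ^ L) ^ 2 * halfRate M ^ l.natAbs := by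
  have hnn : 0 ≤ (tailBound M (α * H.T) 0 * halfRate M ^ L) ^ 2 * halfRate M ^ l.natAbs :=
    mul_nonneg (sq_nonneg _) (pow_nonneg (halfRate_pos M).le _)
  set β : ℝ := 1 / Real.sqrt (8 * L) with hβ
  have hβ0 : 0 ≤ β := by positivity
  have hβ1 : ‖(β : ℂ)‖ ^ 2 ≤ 1 := by
    have hL' : (1 : ℝ) ≤ L := by exact_mod_cast hL
    rw [Complex.norm_real, Real.norm_eq_abs, sq_abs, hβ, inv_sqrt_sq hL,
      div_le_one (by linarith)]
    linarith
  simp only [inner_sub_right, inner_shifted_highProj]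
  by_cases hW : l ∈ window (6 * L) \ window (L + 1)
  · simpa [hW] using hnn
  simp only [if_neg hW, sub_zero, inner_shifted_initial, inner_shifted_mainTerm, ← hβ,
    ← mul_sub, norm_mul, mul_pow (‖(β : ℂ)‖), ← Finset.mul_sum]
  refine (mul_le_of_le_one_left (Finset.sum_nonneg fun _ _ => by positivity) hβ1).trans ?_
  have hW' : l ∈ window (L + 1) ∨ l ∉ window (6 * L) := by
    rw [Finset.mem_sdiff] at hW
    tauto
  rcases hW' with hl | hl
  · have hl3 : l ∈ window (3 * L) := by
      rw [mem_window] at hl ⊢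
      push_cast at hl ⊢
      omega
    -- For `l ∈ [L+1]`, the window `[4L]` contains `j + l` whenever `|j| < 3L`.
    have hJ : ∀ j : ℤ, j.natAbs < 3 * L → j ∈ overlap L l := by
      intro j hj
      rw [mem_window] at hl
      rw [mem_overlap]
      push_cast at hl
      omega
    have h := sum_norm_sq_inner_le (fun b => F.norm_sum_φ_sub_le hα b hJ) (F.φ n 0)
    rw [norm_φ, mul_one] at h
    refine (le_of_eq ?_).trans (h.trans (tailBound_sq_le M _ ?_))
    · refine Finset.sum_congr rfl fun n' _ => ?_
      rw [inner_sub_left, orthonormal_iff_ite.1 (F.orthonormal 0), norm_sub_rev]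
      simp only [hl3, and_true]
    · rw [mem_window] at hl
      push_cast at hl
      omega
  · have hl3 : l ∉ window (3 * L) := by
      rw [mem_window] at hl ⊢
      push_cast at hl ⊢
      omega
    have hJ : ∀ j ∈ overlap L l, l.natAbs - 4 * L ≤ j.natAbs := by
      intro j hj
      rw [mem_window] at hl
      rw [mem_overlap] at hj
      push_cast at hl
      omega
    have h := sum_norm_sq_inner_le (fun b => F.norm_sum_sum_comp_le hα b hJ) (F.φ n 0)
    rw [norm_φ, mul_one] at h
    -- With `k = |l| - 4L`, the condition `2L + |l| ≤ 4k` reads `|l| ≥ 6L`, which is what `l ∉ [6L]`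
    -- provides.
    refine (le_of_eq ?_).trans (h.trans (tailBound_sq_le M _ ?_))
    · simp [hl3]
    · rw [mem_window] at hl
      push_cast at hl
      omega

theorem norm_residual_sub_highProj_le (hα : ∀ m, ‖H.coeff m‖ ≤ α) {L : ℕ} (hL : 1 ≤ L)
    (n : Fin d) :
    ‖(F.initial L n - F.mainTerm L n) - F.highProj L (F.initial L n - F.mainTerm L n)‖ ≤
      tailBound M (α * H.T) 0 * halfRate M ^ L * Real.sqrt (2 / (1 - halfRate M)) := by
  have h1 := halfRate_lt_one M
  have h0 := halfRate_pos M
  have hpos : 0 < 1 - halfRate M := by linarith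
  have hT := tailBound_nonneg M (α * H.T) 0
  refine le_of_sq_le_sq ?_ (by positivity)
  rw [mul_pow, Real.sq_sqrt (by positivity)]
  refine (hasSum_le_of_sum_le (F.hasSum_norm_sq_inner_shifted _) fun S => ?_)
  calc _ ≤ ∑ l ∈ S, (tailBound M (α * H.T) 0 * halfRate M ^ L) ^ 2 * halfRate M ^ l.natAbs :=
        Finset.sum_le_sum fun l _ => F.sum_norm_sq_inner_residual_le hα hL n l
    _ = (tailBound M (α * H.T) 0 * halfRate M ^ L) ^ 2 * ∑ l ∈ S, halfRate M ^ l.natAbs := by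
        rw [Finset.mul_sum]
    _ ≤ _ := by
        gcongr
        simpa using sum_pow_natAbs_le (k := 0) h0.le h1 (J := S) fun _ _ => Nat.zero_le _

end FloquetBasis

end Floquet

end

/-! ### Assembly of the constants -/

open Floquet FloquetBasis in
theorem proposition5 (M : ℕ) :
    ∃ C c₁ c₂ : ℝ, 0 < C ∧ 0 < c₁ ∧ 0 < c₂ ∧
      ∀ (d : ℕ) (H : Floquet.PeriodicHamiltonian d M) (α : ℝ),
        (∀ m : ℤ, ‖H.coeff m‖ ≤ α) →
        ∀ (F : Floquet.FloquetBasis H) (n : Fin d) (L : ℕ), 1 ≤ L →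
          |‖F.initial L n - F.mainTerm L n‖ - 1 / 2| ≤
              27 * (2 * (M : ℝ) + 1) *
                Real.exp (-((L : ℝ) / (2 * (M : ℝ) + 1)) +
                  Real.sinh 1 / (2 * Real.pi) * (α * H.T)) ∧
          ∃ Ψperp Ψneg : Floquet.Sambe d,
            F.initial L n = F.mainTerm L n + (1 / 2 : ℝ) • Ψperp + Ψneg ∧
            ‖Ψperp‖ = 1 ∧
            F.highProj L Ψperp = Ψperp ∧
            ‖Ψneg‖ ≤ C * Real.exp (-(c₁ * (L : ℝ) - c₂ * (α * H.T))) := by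
  have hD : (0 : ℝ) < 2 * M + 1 := by positivity
  have hT0 := tailBound_nonneg M 0 0
  have hsinh : 0 < Real.sinh 1 := Real.sinh_pos_iff.2 one_pos
  -- The two summands of `C` match the two terms of `exists_unit_near`. The rate `c₁` is half the
  -- decay rate, the other half having been spent on summing over shifts.
  refine ⟨2 * (tailBound M 0 0 * Real.sqrt (2 / (1 - halfRate M))) + 27 * (2 * M + 1),
    1 / (2 * (2 * M + 1)), Real.sinh 1 / (2 * Real.pi), by positivity, by positivity,
    by positivity, fun d H α hα F n L hL => ⟨F.abs_norm_residual_sub_half_le hα hL n, ?_⟩⟩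
  -- `6L` is a shift kept by the projection, so it provides the fallback unit vector.
  have hmem : (6 * L : ℤ) ∈ window (6 * L) \ window (L + 1) := by
    rw [Finset.mem_sdiff, mem_window, mem_window]
    push_cast
    omega
  obtain ⟨u, hu1, hPu, hu⟩ := exists_unit_near (F.highProj L) (F.initial L n - F.mainTerm L n)
    (F.highProj_highProj L _) (F.orthonormal_shifted.1 (n, (6 * L : ℤ)))
    (F.highProj_shifted n hmem)
  refine ⟨u, F.initial L n - F.mainTerm L n - (1 / 2 : ℝ) • u, by abel, hu1, hPu, hu.trans ?_⟩
  have h1 := F.norm_residual_sub_highProj_le hα hL n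
  have h2 := F.abs_norm_residual_sub_half_le hα hL n
  set X := Real.exp (Real.sinh 1 / (2 * Real.pi) * (α * H.T)) with hX
  have htail : tailBound M (α * H.T) 0 = tailBound M 0 0 * X := by
    unfold tailBound decayConst
    rw [Real.exp_add, mul_zero, add_zero]
    ring
  have hexp : Real.exp (-(1 / (2 * (2 * M + 1)) * (L : ℝ) -
      Real.sinh 1 / (2 * Real.pi) * (α * H.T))) = halfRate M ^ L * X := by
    rw [halfRate, ← Real.exp_nat_mul, hX, ← Real.exp_add]
    congr 1
    ring
  have hexp2 : Real.exp (-((L : ℝ) / (2 * (M : ℝ) + 1)) +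
      Real.sinh 1 / (2 * Real.pi) * (α * H.T)) ≤ halfRate M ^ L * X := by
    rw [← hexp, Real.exp_le_exp]
    have h3 : (L : ℝ) / (2 * M + 1) = 2 * (1 / (2 * (2 * M + 1)) * L) := by field_simp
    have h4 : 0 ≤ 1 / (2 * (2 * (M : ℝ) + 1)) * L := by positivity
    linarith
  rw [hexp]
  rw [htail] at h1
  have h5 := mul_le_mul_of_nonneg_left hexp2 (by positivity : (0 : ℝ) ≤ 27 * (2 * M + 1))
  linarith
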